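/- **Setting.** Let $A>0$. A *profile function* of half-period $A$ is a smooth even function $f:[-A,A]\to(0,+\infty)$, strictly increasing on $[-A,0]$ (hence strictly decreasing on $[0,A]$), whose $2A$-periodic extension to $\mathbb R$ is smooth. It induces a Riemannian metric $g$ on $\mathbb T^2=\mathbb R/2A\mathbb Z\times\mathbb R/2\pi\mathbb Z$, namely the pull-back of the Euclidean metric of $\mathbb R^3$ by $(x,\theta)\mapsto(x,f(x)\cos\theta,f(x)\sin\theta)$. Put $X(x)=\int_0^x\sqrt{1+f'(t)^2}\,dt$, $T=X(A)$, and define $F:[-T,T]\to(0,+\infty)$ by $F(X(x))=f(x)$; we then say that $g$ is induced by $F$ (in the coordinates $(X,\theta)$, $g=dX^2+F(X)^2d\theta^2$). Let $\check\gamma$ and $\hat\gamma$ be the parallels $X=\pm T$ and $X=0$, parametrized on $\mathbb R/\mathbb Z$ with constant speed and run once in the direction of increasing $\theta$, and let $\alpha$ be their free homotopy class. A closed geodesic is a smooth loop $\gamma:\mathbb R/\mathbb Z\to\mathbb T^2$ with $\nabla_{\dot\gamma}\dot\gamma=0$; closed geodesics are identified if they differ by a rotation of $\mathbb R/\mathbb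 Z$. For the energy $E(\gamma)=\frac12\int_0^1\|\dot\gamma\|_g^2\,dt$ on the Hilbert manifold of $W^{1,2}$ loops, the index $\operatorname{ind}\gamma$ of a closed geodesic $\gamma$ is the maximal dimension of a subspace on which the Hessian of $E$ at $\gamma$ is negative definite; a non-constant $\gamma$ is non-degenerate if the kernel of this Hessian is the line spanned by $\dot\gamma$. **Lemma 1.6.** Let $k,m>0$ with $\sqrt k<m$. There are $\varepsilon_0>0$ and, for each $\varepsilon\in(0,\varepsilon_0)$, a function $F_\varepsilon:[-1,1]\to(0,+\infty)$ such that: 1. $F_\varepsilon$ is a profile function of half-period $1$ and is obtained as above, with $T=1$, from some profile function $f_\varepsilon:[-A_\varepsilon,A_\varepsilon]\to(0,+\infty)$; 2. $F_\varepsilon(X)=\dfrac1{\sqrt{kX^2+m}}$ for all $X\in[-1+\varepsilon,1-\varepsilon]$; 3. for the metric $g$ induced by $F_\varepsilon$, the loops $\check\gamma$ and $\hat\gamma$ are closed geodesics in class $\alpha$, and there are no other closed geodesics in class $\alpha$; 4. $\check\gamma$ and $\hat\gamma$ are non-degenerate, with $\operatorname{ind}\check\gamma=0$ and $\operatorname{ind}\hat\gamma=1$;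 5. $F_\varepsilon\to\dfrac1{\sqrt{kX^2+m}}$ uniformly on $[-1,1]$ as $\varepsilon\to0$. -/

import Mathlib

open Real Set Filter Topology MeasureTheory
open scoped ContDiff Matrix

noncomputable section

namespace TorusOfRevolution

/-! ### Profile functions -/

/-- `f : [-A, A] → (0, ∞)` is the profile function of a torus of revolution: it is smooth, positive,
even, strictly increasing on `[-A, 0]` (hence strictly decreasing on `[0, A]`), and its
`2A`-periodic extension is smooth. We work with that (unique) extension to `ℝ`. -/
structure IsProfile (A : ℝ) (f : ℝ → ℝ) : Prop where
  half_period_pos : 0 < A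
  smooth : ContDiff ℝ ∞ f
  pos : ∀ x, 0 < f x
  even : ∀ x, f (-x) = f x
  periodic : Function.Periodic f (2 * A)
  strictMonoOn : StrictMonoOn f (Icc (-A) 0)

/-- The change of variable `X(x) = ∫₀ˣ √(1 + f'(t)²) dt`. -/
def arcLength (f : ℝ → ℝ) (x : ℝ) : ℝ := ∫ t in (0 : ℝ)..x, √(1 + deriv f t ^ 2)

/-- `F : [-T, T] → ℝ` is the profile `f : [-A, A] → ℝ` written in the variable `X`:
`X(A) = T` and `F (X(x)) = f x` on `[-A, A]`. -/
def IsArcLengthForm (A : ℝ) (f : ℝ → ℝ) (T : ℝ) (F : ℝ → ℝ) : Prop :=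
  arcLength f A = T ∧ ∀ x ∈ Icc (-A) A, F (arcLength f x) = f x

/-! ### Riemannian geometry in the global coordinates `(x, θ)` of the universal cover `ℝ²` -/

/-- The coordinate plane; coordinate `0` is `x`, coordinate `1` is `θ`. -/
abbrev Plane := Fin 2 → ℝ

/-- The map `(x, θ) ↦ (x, f(x) cos θ, f(x) sin θ)` into Euclidean space. -/
def revolutionMap (f : ℝ → ℝ) (p : Plane) : EuclideanSpace ℝ (Fin 3) :=
  !₂[p 0, f (p 0) * cos (p 1), f (p 0) * sin (p 1)]

/-- Coordinate vector `∂ᵢ`. -/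
def coordVec (i : Fin 2) : Plane := Pi.single i 1

/-- The matrix `g i j` of the metric induced from the Euclidean metric by `revolutionMap f`. It is
`2A`-periodic in `x` and `2π`-periodic in `θ`, so it is a metric on the torus. -/
def revolutionMetric (f : ℝ → ℝ) (p : Plane) : Matrix (Fin 2) (Fin 2) ℝ :=
  Matrix.of fun i j => inner ℝ (fderiv ℝ (revolutionMap f) p (coordVec i))
    (fderiv ℝ (revolutionMap f) p (coordVec j))

/-- Christoffel symbols
`Γˡᵢⱼ = ½ ∑ₙ gˡⁿ (∂ᵢ gⱼₙ + ∂ⱼ gᵢₙ - ∂ₙ gᵢⱼ)` of the Levi-Civita connection of `g`. -/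
def christoffel (g : Plane → Matrix (Fin 2) (Fin 2) ℝ) (l i j : Fin 2) (p : Plane) : ℝ :=
  1 / 2 * ∑ n, (g p)⁻¹ l n *
    (fderiv ℝ (fun q => g q j n) p (coordVec i) + fderiv ℝ (fun q => g q i n) p (coordVec j)
      - fderiv ℝ (fun q => g q i j) p (coordVec n))

/-- The covariant derivative `∇_ċ V` of a vector field `V` along a curve `c`:
`(∇_ċ V)ˡ = V̇ˡ + ∑ᵢⱼ Γˡᵢⱼ(c) ċⁱ Vʲ`. -/
def covDerivAlong (g : Plane → Matrix (Fin 2) (Fin 2) ℝ) (c V : ℝ → Plane) (t : ℝ) : Plane :=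
  fun l => deriv V t l + ∑ i, ∑ j, christoffel g l i j (c t) * deriv c t i * V t j

/-- The energy `½ ∫₀¹ ‖ċ(t)‖²_g dt`. -/
def energy (g : Plane → Matrix (Fin 2) (Fin 2) ℝ) (c : ℝ → Plane) : ℝ :=
  1 / 2 * ∫ t in (0 : ℝ)..1, deriv c t ⬝ᵥ (g (c t) *ᵥ deriv c t)

/-! ### Loops in the torus -/

/-- The torus `ℝ / 2Aℤ × ℝ / 2πℤ`. -/
abbrev Torus (A : ℝ) := AddCircle (2 * A) × AddCircle (2 * π)

/-- The parameter circle `ℝ / ℤ`. -/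
abbrev LoopCircle := AddCircle (1 : ℝ)

/-- The covering map `ℝ² → ℝ / 2Aℤ × ℝ / 2πℤ`. -/
def cover (A : ℝ) (p : Plane) : Torus A := ((p 0 : AddCircle (2 * A)), (p 1 : AddCircle (2 * π)))

/-- `c : ℝ → ℝ²` is a continuous lift of the loop `γ` to the universal cover. -/
def IsLift {A : ℝ} (γ : C(LoopCircle, Torus A)) (c : ℝ → Plane) : Prop :=
  Continuous c ∧ ∀ t : ℝ, γ (t : LoopCircle) = cover A (c t)

/-- The parallel `t ↦ (x₀, 2πt)`, run once in the direction of increasing `θ`. -/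
def parallel (A x₀ : ℝ) : C(LoopCircle, Torus A) where
  toFun t := ((x₀ : AddCircle (2 * A)),
    AddCircle.homeomorphAddCircle 1 (2 * π) one_ne_zero two_pi_pos.ne' t)
  continuous_toFun := by fun_prop

/-- The reparametrized loop `(s · γ)(t) = γ(t + s)`. -/
def rotate {A : ℝ} (s : LoopCircle) (γ : C(LoopCircle, Torus A)) : C(LoopCircle, Torus A) where
  toFun t := γ (t + s)
  continuous_toFun := by fun_prop

/-- `γ` lies in the free homotopy class `α` of the parallels. -/
def InClassAlpha {A : ℝ} (γ : C(LoopCircle, Torus A)) : Prop :=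
  ContinuousMap.Homotopic γ (parallel A 0)

/-- `γ` is a closed geodesic: a smooth loop with `∇_γ̇ γ̇ = 0`. Being local, the condition is
expressed through a lift of `γ`. -/
def IsClosedGeodesic {A : ℝ} (g : Plane → Matrix (Fin 2) (Fin 2) ℝ)
    (γ : C(LoopCircle, Torus A)) : Prop :=
  ∃ c, IsLift γ c ∧ ContDiff ℝ ∞ c ∧ ∀ t, covDerivAlong g c (deriv c) t = 0

/-! ### Second variation of the energy -/

/-- The space `W^{1,2}(ℝ/ℤ, ℝ²)`: 1-periodic functions that are integrals of a square-integrable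
function. For a closed geodesic with lift `c` it is the tangent space at that geodesic to the Hilbert
manifold of `W^{1,2}` loops in the torus, and `ξ ↦ c + ξ` is a chart of this manifold. -/
def sobolevFields : Submodule ℝ (ℝ → Plane) where
  carrier := {ξ | Function.Periodic ξ 1 ∧ ∃ v : ℝ → Plane,
    MemLp v 2 (volume.restrict (Ioc (0 : ℝ) 1)) ∧
      ∀ t ∈ Icc (0 : ℝ) 1, ξ t = ξ 0 + ∫ τ in (0 : ℝ)..t, v τ}
  zero_mem' := ⟨fun _ => rfl, 0, MemLp.zero, by simp⟩
  add_mem' := by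
    rintro ξ η ⟨hξ, v, hv, hξv⟩ ⟨hη, w, hw, hηw⟩
    refine ⟨hξ.add hη, v + w, hv.add hw, fun t ht => ?_⟩
    have key : ∀ u : ℝ → Plane, MemLp u 2 (volume.restrict (Ioc (0 : ℝ) 1)) →
        IntervalIntegrable u volume 0 t := fun u hu => by
      have h : IntegrableOn u (Ioc 0 1) volume := hu.integrable (by norm_num)
      exact (intervalIntegrable_iff_integrableOn_Ioc_of_le ht.1).2
        (h.mono_set (Ioc_subset_Ioc_right ht.2))
    have := intervalIntegral.integral_add (key v hv) (key w hw)
    simp only [Pi.add_apply] at this ⊢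
    rw [this, hξv t ht, hηw t ht]
    abel
  smul_mem' := by
    rintro a ξ ⟨hξ, v, hv, hξv⟩
    refine ⟨hξ.smul a, a • v, hv.const_smul a, fun t ht => ?_⟩
    simp only [Pi.smul_apply, intervalIntegral.integral_smul]
    rw [hξv t ht, smul_add]

/-- The Hessian of the energy at a critical point with lift `c`, in the chart `ξ ↦ c + ξ`:
`Hess(ξ, η) = ∂²/∂r∂s E(c + sξ + rη)` at `s = r = 0`. -/
def hessian (g : Plane → Matrix (Fin 2) (Fin 2) ℝ) (c ξ η : ℝ → Plane) : ℝ :=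
  deriv (fun r : ℝ => deriv (fun s : ℝ => energy g (c + s • ξ + r • η)) 0) 0

/-- `γ` is a non-degenerate non-constant closed geodesic: the kernel of the Hessian of the energy at
`γ` is the tangent line `ℝ γ̇` of the orbit `S¹ · γ`. -/
def IsNondegenerate {A : ℝ} (g : Plane → Matrix (Fin 2) (Fin 2) ℝ)
    (γ : C(LoopCircle, Torus A)) : Prop :=
  IsClosedGeodesic g γ ∧ ∃ c, IsLift γ c ∧ deriv c ≠ 0 ∧
    ∀ ξ ∈ sobolevFields,
      (∀ η ∈ sobolevFields, hessian g c ξ η = 0) ↔ ∃ a : ℝ, ξ = a • deriv c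

/-- The Morse index at a critical point with lift `c`: the maximal dimension of a space of
`W^{1,2}` fields on which the Hessian of the energy is negative definite. -/
def morseIndex (g : Plane → Matrix (Fin 2) (Fin 2) ℝ) (c : ℝ → Plane) : ℕ∞ :=
  ⨆ (V : Submodule ℝ (ℝ → Plane)) (_ : V ≤ sobolevFields)
    (_ : ∀ ξ ∈ V, ξ ≠ 0 → hessian g c ξ ξ < 0), Cardinal.toENat (Module.rank ℝ V)

/-- The closed geodesic `γ` has index `n`. (Two lifts of `γ` differ by a deck transformation, which
leaves the metric, hence the index, unchanged.) -/
def HasIndex {A : ℝ} (g : Plane → Matrix (Fin 2) (Fin 2) ℝ)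
    (γ : C(LoopCircle, Torus A)) (n : ℕ∞) : Prop :=
  ∃ c, IsLift γ c ∧ morseIndex g c = n

end TorusOfRevolution

end

/-!
Write the profile as `F = 1 / √W`. In the arc-length coordinate `Y`, Clairaut's integral `κ = F² θ'`
turns the geodesic equations into the motion in a potential, `Y'' = -κ² w(Y)` with `w = W' / 2`,
together with `θ' = κ W(Y)`. For `W = k Y² + m` this is a harmonic oscillator, and the condition
`√k < m` says that its period exceeds the time needed to turn once around the axis.

The force `w` is chosen smooth, odd and 2-periodic, equal to `k Y` away from the odd integers,
positive on `(0, 1)`, with `w' ≤ k` everywhere (`exists_isForce`). A closed geodesic homotopic to the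
parallels has `Y` 1-periodic and `κ ∫ W(Y) = 2π`; as `W ≥ m`, this gives `0 < κ ≤ 2π / m`, hence
`κ² k < 4π²` because `k < m²`. Its velocity `Z = Y'` has mean zero and satisfies
`∫ Z'² = κ² ∫ w'(Y) Z² ≤ κ² k ∫ Z²`, so that `Z = 0` by Wirtinger's inequality `4π² ∫ Z² ≤ ∫ Z'²`
(`velocity_eq_zero`). Thus `Y` is constant and `w(Y) = 0`: the geodesic is one of the two parallels.

At a parallel `x = x₀` the Hessian of the energy for the metric `E dx² + G dθ²` is
`E ∫ ξ₀' η₀' + 2π² G'' ∫ ξ₀ η₀ + G ∫ ξ₁' η₁'` (`hessian_parallel`), where `G = f²` and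
`G'' = -2 w' E G²` at `x₀`. At `Y = 1` one has `G'' > 0`, which gives index `0`. At `Y = 0` one has
`2π² G'' = -4π² (k / m²) E > -4π² E`, so that, again by Wirtinger's inequality, only constant fields
contribute to the index, which is `1`.

Since `√k < m`, also `|F'| < 1` for small `ε`, and then `F` is the arc-length form of a graph
(`exists_profile_of_arcLength`).
-/

noncomputable section

namespace TorusOfRevolution

/-! ### Wirtinger's inequality on the circle -/

/-- On `[0, 1]` the function `u` is an integral of the square-integrable function `v`; this is how
`sobolevFields` encodes membership in `W^{1,2}`, for one real component. -/
structure IsSobolevPair (u v : ℝ → ℝ) : Prop where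
  memLp : MemLp v 2 (volume.restrict (Ioc (0 : ℝ) 1))
  eq_integral : ∀ t ∈ Icc (0 : ℝ) 1, u t = u 0 + ∫ τ in (0 : ℝ)..t, v τ

namespace IsSobolevPair

variable {u v : ℝ → ℝ}

theorem intervalIntegrable (h : IsSobolevPair u v) : IntervalIntegrable v volume 0 1 :=
  (intervalIntegrable_iff_integrableOn_Ioc_of_le zero_le_one).2 (h.memLp.integrable (by norm_num))

theorem absolutelyContinuousOnInterval (h : IsSobolevPair u v) :
    AbsolutelyContinuousOnInterval u 0 1 := by
  have h1 := h.intervalIntegrable.absolutelyContinuousOnInterval_intervalIntegral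
    (c := 0) (by simp)
  have h2 : AbsolutelyContinuousOnInterval (fun _ : ℝ => u 0) 0 1 :=
    (LipschitzWith.const (u 0)).lipschitzOnWith.absolutelyContinuousOnInterval
  have h3 := h2.add h1
  have key : ∀ t ∈ uIcc (0 : ℝ) 1, u t = u 0 + ∫ τ in (0 : ℝ)..t, v τ := fun t ht =>
    h.eq_integral t (by rwa [uIcc_of_le zero_le_one] at ht)
  refine Tendsto.congr' ?_ h3
  filter_upwards [mem_inf_of_right (mem_principal_self
    (AbsolutelyContinuousOnInterval.disjWithin 0 1))] with E hE
  refine Finset.sum_congr rfl fun i hi => ?_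
  rw [key _ (hE.1 i hi).1, key _ (hE.1 i hi).2]
  rfl

theorem continuousOn (h : IsSobolevPair u v) : ContinuousOn u (Icc 0 1) := by
  simpa [uIcc_of_le] using h.absolutelyContinuousOnInterval.continuousOn

theorem ae_hasDerivAt (h : IsSobolevPair u v) :
    ∀ᵐ t, t ∈ Ioc (0 : ℝ) 1 → HasDerivAt u (v t) t := by
  have h1 : ∀ᵐ x : ℝ, x ≠ 1 := by simp [ae_iff, measure_singleton]
  filter_upwards [h.intervalIntegrable.ae_hasDerivAt_integral, h1] with t ht ht1 hmem
  have := (ht (by rw [uIcc_of_le zero_le_one]; exact Ioc_subset_Icc_self hmem) 0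
    (by simp)).const_add (u 0)
  refine this.congr_of_eventuallyEq ?_
  filter_upwards [Ioo_mem_nhds hmem.1 (lt_of_le_of_ne hmem.2 ht1)] with s hs
  exact h.eq_integral s (Ioo_subset_Icc_self hs)

theorem memLp_self (h : IsSobolevPair u v) : MemLp u 2 (volume.restrict (Ioc (0 : ℝ) 1)) := by
  obtain ⟨C, hC⟩ := isCompact_Icc.exists_bound_of_continuousOn h.continuousOn
  refine MemLp.of_bound
    ((h.continuousOn.mono Ioc_subset_Icc_self).aestronglyMeasurable measurableSet_Ioc) C ?_
  exact (ae_restrict_iff' measurableSet_Ioc).2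
    (Eventually.of_forall fun t ht => hC t (Ioc_subset_Icc_self ht))

/-- Integration by parts against a smooth function. -/
theorem integral_mul_deriv (h : IsSobolevPair u v) {g g' : ℝ → ℝ}
    (hg : ∀ t, HasDerivAt g (g' t) t) (hg' : Continuous g') :
    ∫ t in (0 : ℝ)..1, v t * g t = u 1 * g 1 - u 0 * g 0 - ∫ t in (0 : ℝ)..1, u t * g' t := by
  have hgc : ContDiff ℝ 1 g := by
    rw [contDiff_one_iff_deriv]
    refine ⟨fun t => (hg t).differentiableAt, ?_⟩
    convert hg' using 1
    exact funext fun t => (hg t).deriv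
  have hgac : AbsolutelyContinuousOnInterval g 0 1 :=
    hgc.contDiffOn.absolutelyContinuousOnInterval
  have key := h.absolutelyContinuousOnInterval.integral_mul_deriv_eq_deriv_mul hgac
  have e1 : ∫ t in (0 : ℝ)..1, u t * deriv g t = ∫ t in (0 : ℝ)..1, u t * g' t := by
    simp [fun t => (hg t).deriv]
  have e2 : ∫ t in (0 : ℝ)..1, deriv u t * g t = ∫ t in (0 : ℝ)..1, v t * g t := by
    refine intervalIntegral.integral_congr_ae ?_
    filter_upwards [h.ae_hasDerivAt] with t ht hmem
    rw [uIoc_of_le zero_le_one] at hmem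
    rw [(ht hmem).deriv]
  rw [e1, e2] at key
  linarith

end IsSobolevPair

/-- The Fourier coefficients of a real function on `[0, 1]` in terms of its cosine and sine
integrals. -/
theorem fourierCoeffOn_ofReal {u : ℝ → ℝ} (hu : IntervalIntegrable u volume 0 1) (n : ℤ) :
    fourierCoeffOn (zero_lt_one (α := ℝ)) (fun t => (u t : ℂ)) n =
      ((∫ t in (0 : ℝ)..1, u t * cos (2 * π * n * t) : ℝ) : ℂ) -
        Complex.I * ((∫ t in (0 : ℝ)..1, u t * sin (2 * π * n * t) : ℝ) : ℂ) := by
  rw [fourierCoeffOn_eq_integral, ← intervalIntegral.integral_ofReal,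
    ← intervalIntegral.integral_ofReal, ← intervalIntegral.integral_const_mul,
    ← intervalIntegral.integral_sub]
  · simp only [show (1 : ℝ) / (1 - 0) = 1 by norm_num, one_smul]
    refine intervalIntegral.integral_congr fun t _ => ?_
    rw [fourier_coe_apply, smul_eq_mul]
    have : (2 * π * Complex.I * ((-n : ℤ) : ℂ) * t / ((1 - 0 : ℝ) : ℂ)) =
        ((-(2 * π * n * t) : ℝ) : ℂ) * Complex.I := by push_cast; ring
    rw [this, Complex.exp_mul_I, ← Complex.ofReal_cos, ← Complex.ofReal_sin, cos_neg, sin_neg]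
    push_cast
    ring
  · have := hu.mul_continuousOn (g := fun t => cos (2 * π * n * t)) (by fun_prop)
    exact ⟨this.1.ofReal, this.2.ofReal⟩
  · have := hu.mul_continuousOn (g := fun t => sin (2 * π * n * t)) (by fun_prop)
    exact IntervalIntegrable.const_mul ⟨this.1.ofReal, this.2.ofReal⟩ _

theorem norm_fourierCoeffOn_deriv {u v : ℝ → ℝ} (h : IsSobolevPair u v) (hper : u 1 = u 0)
    (n : ℤ) :
    ‖fourierCoeffOn (zero_lt_one (α := ℝ)) (fun t => (v t : ℂ)) n‖ ^ 2 = (2 * π) ^ 2 * n ^ 2 *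
      ‖fourierCoeffOn (zero_lt_one (α := ℝ)) (fun t => (u t : ℂ)) n‖ ^ 2 := by
  have hu : IntervalIntegrable u volume 0 1 :=
    ContinuousOn.intervalIntegrable_of_Icc zero_le_one h.continuousOn
  rw [fourierCoeffOn_ofReal h.intervalIntegrable, fourierCoeffOn_ofReal hu]
  have hlin : ∀ t : ℝ, HasDerivAt (fun t => 2 * π * n * t) (2 * π * n) t := fun t => by
    simpa using (hasDerivAt_id t).const_mul (2 * π * n)
  have hc := h.integral_mul_deriv (fun t => (hlin t).cos) (by fun_prop)
  have hs := h.integral_mul_deriv (fun t => (hlin t).sin) (by fun_prop)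
  have e1 : cos (2 * π * n * 1) = 1 := by
    rw [show 2 * π * n * 1 = n * (2 * π) by ring, cos_int_mul_two_pi]
  have e2 : sin (2 * π * n * 1) = 0 := by
    rw [show 2 * π * n * 1 = ((2 * n : ℤ) : ℝ) * π by push_cast; ring, sin_int_mul_pi]
  have c1 : ∫ t in (0 : ℝ)..1, u t * (-sin (2 * π * n * t) * (2 * π * n)) =
      -(2 * π * n) * ∫ t in (0 : ℝ)..1, u t * sin (2 * π * n * t) := by
    rw [← intervalIntegral.integral_const_mul]
    congr 1; ext t; ring
  have c2 : ∫ t in (0 : ℝ)..1, u t * (cos (2 * π * n * t) * (2 * π * n)) =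
      (2 * π * n) * ∫ t in (0 : ℝ)..1, u t * cos (2 * π * n * t) := by
    rw [← intervalIntegral.integral_const_mul]
    congr 1; ext t; ring
  rw [c1, e1, hper] at hc
  rw [c2, e2] at hs
  simp only [mul_zero, cos_zero, sin_zero] at hc hs
  rw [hc, hs]
  have nrm : ∀ a b : ℝ, ‖(a : ℂ) - Complex.I * (b : ℂ)‖ ^ 2 = a ^ 2 + b ^ 2 := fun a b => by
    rw [← Complex.normSq_eq_norm_sq, Complex.normSq_apply]
    simp
    ring
  rw [nrm, nrm]
  ring

/-- **Wirtinger's inequality**: a 1-periodic `W^{1,2}` function of mean zero satisfies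
`4π² ∫ u² ≤ ∫ u'²`. By Parseval, this compares the Fourier coefficients term by term. -/
theorem wirtinger_inequality {u v : ℝ → ℝ} (h : IsSobolevPair u v) (hper : u 1 = u 0)
    (hmean : ∫ t in (0 : ℝ)..1, u t = 0) :
    (2 * π) ^ 2 * ∫ t in (0 : ℝ)..1, u t ^ 2 ≤ ∫ t in (0 : ℝ)..1, v t ^ 2 := by
  have hu : IntervalIntegrable u volume 0 1 :=
    ContinuousOn.intervalIntegrable_of_Icc zero_le_one h.continuousOn
  have pu := hasSum_sq_fourierCoeffOn (zero_lt_one (α := ℝ)) h.memLp_self.ofReal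
    (f := fun t => (u t : ℂ))
  have pv := hasSum_sq_fourierCoeffOn (zero_lt_one (α := ℝ)) h.memLp.ofReal
    (f := fun t => (v t : ℂ))
  simp only [sub_zero, inv_one, one_smul, Complex.norm_real, norm_eq_abs, sq_abs] at pu pv
  refine hasSum_le (fun n => ?_) (pu.mul_left ((2 * π) ^ 2)) pv
  rw [norm_fourierCoeffOn_deriv h hper]
  rcases eq_or_ne n 0 with rfl | hn
  · rw [fourierCoeffOn_ofReal hu]
    simp [hmean]
  · have : (1 : ℝ) ≤ (n : ℝ) ^ 2 := by
      have h1 : 1 ≤ n ^ 2 := (sq_pos_iff.2 hn : (0 : ℤ) < n ^ 2)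
      exact_mod_cast h1
    have h2 : 0 ≤ (2 * π) ^ 2 * ‖fourierCoeffOn (zero_lt_one (α := ℝ)) (fun t => (u t : ℂ)) n‖ ^ 2 :=
      by positivity
    nlinarith

/-! ### The metric of revolution in coordinates -/

theorem fderiv_revolutionMap {f : ℝ → ℝ} (hf : ContDiff ℝ ∞ f) (p v : Plane) :
    fderiv ℝ (revolutionMap f) p v =
      !₂[v 0, deriv f (p 0) * v 0 * cos (p 1) - f (p 0) * sin (p 1) * v 1,
        deriv f (p 0) * v 0 * sin (p 1) + f (p 0) * cos (p 1) * v 1] := by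
  have h0 : HasFDerivAt (fun q : Plane => q 0) (ContinuousLinearMap.proj (R := ℝ) 0) p :=
    hasFDerivAt_apply 0 p
  have h1 : HasFDerivAt (fun q : Plane => q 1) (ContinuousLinearMap.proj (R := ℝ) 1) p :=
    hasFDerivAt_apply 1 p
  have hfd : HasDerivAt f (deriv f (p 0)) (p 0) :=
    (hf.differentiable (by simp)).differentiableAt.hasDerivAt
  have hF := hfd.comp_hasFDerivAt p h0
  have H : HasFDerivAt (revolutionMap f) (((EuclideanSpace.equiv (Fin 3) ℝ).symm :
      (Fin 3 → ℝ) →L[ℝ] EuclideanSpace ℝ (Fin 3)).comp (ContinuousLinearMap.pi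
      ![ContinuousLinearMap.proj (R := ℝ) 0,
        f (p 0) • (-sin (p 1)) • (ContinuousLinearMap.proj (R := ℝ) 1 : Plane →L[ℝ] ℝ) +
          cos (p 1) • deriv f (p 0) • (ContinuousLinearMap.proj (R := ℝ) 0 : Plane →L[ℝ] ℝ),
        f (p 0) • cos (p 1) • (ContinuousLinearMap.proj (R := ℝ) 1 : Plane →L[ℝ] ℝ) +
          sin (p 1) • deriv f (p 0) • (ContinuousLinearMap.proj (R := ℝ) 0 : Plane →L[ℝ] ℝ)])) p
      := by
    refine ((EuclideanSpace.equiv (Fin 3) ℝ).symm :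
      (Fin 3 → ℝ) →L[ℝ] EuclideanSpace ℝ (Fin 3)).hasFDerivAt.comp p
      (f := fun q : Plane => ![q 0, f (q 0) * cos (q 1), f (q 0) * sin (q 1)]) ?_
    rw [hasFDerivAt_pi']
    intro i
    fin_cases i
    · exact h0
    · exact hF.mul h1.cos
    · exact hF.mul h1.sin
  rw [H.fderiv]
  ext i
  fin_cases i <;> simp <;> ring

theorem revolutionMetric_eq {f : ℝ → ℝ} (hf : ContDiff ℝ ∞ f) (p : Plane) :
    revolutionMetric f p = Matrix.diagonal ![1 + deriv f (p 0) ^ 2, f (p 0) ^ 2] := by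
  have hsc := sin_sq_add_cos_sq (p 1)
  ext i j
  simp only [revolutionMetric, Matrix.of_apply, fderiv_revolutionMap hf, PiLp.inner_apply,
    Fin.sum_univ_three]
  fin_cases i <;> fin_cases j <;> simp [coordVec] <;> grind

/-- A metric on the plane of the form `E(x) dx² + G(x) dθ²`. -/
def diagMetric (E G : ℝ → ℝ) (p : Plane) : Matrix (Fin 2) (Fin 2) ℝ :=
  Matrix.diagonal ![E (p 0), G (p 0)]

theorem revolutionMetric_eq_diagMetric {f : ℝ → ℝ} (hf : ContDiff ℝ ∞ f) :
    revolutionMetric f = diagMetric (fun x => 1 + deriv f x ^ 2) (fun x => f x ^ 2) :=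
  funext fun p => revolutionMetric_eq hf p

theorem dotProduct_diagMetric (E G : ℝ → ℝ) (p v : Plane) :
    v ⬝ᵥ (diagMetric E G p *ᵥ v) = E (p 0) * v 0 ^ 2 + G (p 0) * v 1 ^ 2 := by
  simp [diagMetric, Matrix.mulVec_diagonal, dotProduct, Fin.sum_univ_two]
  ring

theorem fderiv_comp_fst {E : ℝ → ℝ} (hE : Differentiable ℝ E) (p v : Plane) :
    fderiv ℝ (fun q : Plane => E (q 0)) p v = deriv E (p 0) * v 0 := by
  have h0 : HasFDerivAt (fun q : Plane => q 0) (ContinuousLinearMap.proj (R := ℝ) 0) p :=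
    hasFDerivAt_apply 0 p
  have := (hE (p 0)).hasDerivAt.comp_hasFDerivAt p h0
  rw [show (fun q : Plane => E (q 0)) = E ∘ fun q : Plane => q 0 from rfl, this.fderiv]
  simp

theorem covDerivAlong_diagMetric {E G : ℝ → ℝ} (hE : Differentiable ℝ E) (hG : Differentiable ℝ G)
    (hE0 : ∀ x, E x ≠ 0) (hG0 : ∀ x, G x ≠ 0) (c V : ℝ → Plane) (t : ℝ) :
    covDerivAlong (diagMetric E G) c V t 0 = deriv V t 0 +
        (deriv E (c t 0) * (deriv c t 0 * V t 0) - deriv G (c t 0) * (deriv c t 1 * V t 1)) /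
          (2 * E (c t 0)) ∧
      covDerivAlong (diagMetric E G) c V t 1 = deriv V t 1 +
        deriv G (c t 0) * (deriv c t 0 * V t 1 + deriv c t 1 * V t 0) / (2 * G (c t 0)) := by
  have hinv : (diagMetric E G (c t))⁻¹ = Matrix.diagonal ![(E (c t 0))⁻¹, (G (c t 0))⁻¹] := by
    refine Matrix.inv_eq_left_inv ?_
    rw [diagMetric, Matrix.diagonal_mul_diagonal, ← Matrix.diagonal_one]
    congr 1
    ext i
    fin_cases i <;> simp [hE0, hG0]
  have e00 : (fun q : Plane => diagMetric E G q 0 0) = fun q => E (q 0) := by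
    ext q; simp [diagMetric]
  have e11 : (fun q : Plane => diagMetric E G q 1 1) = fun q => G (q 0) := by
    ext q; simp [diagMetric]
  have e01 : (fun q : Plane => diagMetric E G q 0 1) = fun _ => 0 := by
    ext q; simp [diagMetric]
  have e10 : (fun q : Plane => diagMetric E G q 1 0) = fun _ => 0 := by
    ext q; simp [diagMetric]
  have hE1 := hE0 (c t 0)
  have hG1 := hG0 (c t 0)
  constructor
  · simp only [covDerivAlong, christoffel, Fin.sum_univ_two, hinv, e00, e11, e01, e10,
      fderiv_comp_fst hE, fderiv_comp_fst hG, coordVec]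
    simp
    field_simp
    ring
  · simp only [covDerivAlong, christoffel, Fin.sum_univ_two, hinv, e00, e11, e01, e10,
      fderiv_comp_fst hE, fderiv_comp_fst hG, coordVec]
    simp
    field_simp

/-! ### Lifts of loops homotopic to the parallels -/

/-- Two continuous functions that agree modulo `p` differ by a constant. -/
theorem sub_eq_sub_of_coe_eq {X : Type*} [TopologicalSpace X] [PreconnectedSpace X] {p : ℝ}
    {φ ψ : X → ℝ} (hφ : Continuous φ) (hψ : Continuous ψ)
    (h : ∀ x, (φ x : AddCircle p) = ψ x) (x y : X) : φ x - ψ x = φ y - ψ y := by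
  have key := (AddCircle.isCoveringMap_coe p).eq_of_comp_eq (g₁ := fun x => φ x - ψ x)
    (g₂ := fun _ => φ y - ψ y) (hφ.sub hψ) continuous_const
    (by ext x; simp [h]) y rfl
  exact congrFun key x

/-- The displacement of a lift after one turn is invariant under free homotopies of loops. -/
theorem lift_displacement_eq {p : ℝ} {H : C(unitInterval × LoopCircle, AddCircle p)}
    {a b : ℝ → ℝ} (ha : Continuous a) (hb : Continuous b)
    (hHa : ∀ t : ℝ, H (0, (t : LoopCircle)) = a t) (hHb : ∀ t : ℝ, H (1, (t : LoopCircle)) = b t)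
    (t t' : ℝ) : a (t + 1) - a t = b (t' + 1) - b t' := by
  have cov := AddCircle.isCoveringMap_coe p
  let K : C(unitInterval × ℝ, AddCircle p) :=
    H.comp ⟨fun q => (q.1, (q.2 : LoopCircle)), by fun_prop⟩
  have hK : ∀ s t, K (s, t) = H (s, (t : LoopCircle)) := fun _ _ => rfl
  let Φ := cov.liftHomotopy K ⟨a, ha⟩ fun t => by rw [hK, hHa]; rfl
  have hΦ : ∀ s t, (Φ (s, t) : AddCircle p) = H (s, (t : LoopCircle)) := fun s t =>
    congrFun (cov.liftHomotopy_lifts K ⟨a, ha⟩ _) (s, t)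
  have hΦ0 : ∀ t, Φ (0, t) = a t := fun t => cov.liftHomotopy_zero K ⟨a, ha⟩ _ t
  have h1 := sub_eq_sub_of_coe_eq (p := p) (φ := fun q : unitInterval × ℝ => Φ (q.1, q.2 + 1))
    (ψ := fun q => Φ (q.1, q.2)) (by fun_prop) (by fun_prop)
    (fun q => by
      rw [hΦ, hΦ, AddCircle.coe_add, AddCircle.coe_period, add_zero]) (0, t) (1, t')
  have h2 := sub_eq_sub_of_coe_eq (p := p) (φ := fun s : ℝ => Φ (1, s)) (ψ := b) (by fun_prop) hb
    (fun s => by rw [hΦ, hHb]) (t' + 1) t'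
  simp only [hΦ0] at h1
  linarith

theorem isLift_parallel (A x₀ : ℝ) : IsLift (parallel A x₀) fun t => ![x₀, 2 * π * t] := by
  refine ⟨?_, fun t => ?_⟩
  · refine continuous_pi fun i => ?_
    fin_cases i
    · exact continuous_const
    · exact continuous_const.mul continuous_id
  · refine Prod.ext rfl ?_
    change AddCircle.equivAddCircle 1 (2 * π) one_ne_zero two_pi_pos.ne' t = _
    rw [AddCircle.equivAddCircle_apply_mk]
    simp [cover, mul_comm]

/-- A lift of a loop in the class of the parallels gains `(0, 2π)` after one turn. -/
theorem IsLift.add_one {A : ℝ} {γ : C(LoopCircle, Torus A)} {c : ℝ → Plane} (hc : IsLift γ c)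
    (hγ : InClassAlpha γ) (t : ℝ) : c (t + 1) 0 = c t 0 ∧ c (t + 1) 1 = c t 1 + 2 * π := by
  obtain ⟨H⟩ := hγ
  have hp := isLift_parallel A 0
  have cc : ∀ {d : ℝ → Plane}, Continuous d → ∀ i, Continuous fun t => d t i := fun h i =>
    (continuous_apply i).comp h
  have h0 := lift_displacement_eq (H := ContinuousMap.fst.comp H.toContinuousMap)
    (cc hc.1 0) (cc hp.1 0) (fun t => ?_) (fun t => ?_) t 0
  have h1 := lift_displacement_eq (H := ContinuousMap.snd.comp H.toContinuousMap)
    (cc hc.1 1) (cc hp.1 1) (fun t => ?_) (fun t => ?_) t 0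
  · simp only [Matrix.cons_val_zero, Matrix.cons_val_one] at h0 h1
    constructor <;> linarith
  · simp [hc.2 t, cover]
  · simp [hp.2 t, cover]
  · simp [hc.2 t, cover]
  · simp [hp.2 t, cover]

theorem inClassAlpha_parallel (A x₀ : ℝ) : InClassAlpha (parallel A x₀) := by
  refine ⟨⟨⟨fun q => ((((1 - q.1 : ℝ) * x₀ : ℝ) : AddCircle (2 * A)), (parallel A 0 q.2).2),
    ?_⟩, ?_, ?_⟩⟩
  · refine Continuous.prodMk ?_ (by fun_prop)
    exact (AddCircle.continuous_mk' _).comp (by fun_prop)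
  · intro t
    simp [parallel]
  · intro t
    simp [parallel]

theorem eq_rotate_parallel {A x₀ x₁ b : ℝ} {γ : C(LoopCircle, Torus A)} {c : ℝ → Plane}
    (hc : IsLift γ c) (h0 : ∀ t, c t 0 = x₀) (h1 : ∀ t, c t 1 = 2 * π * t + b)
    (hx : (x₀ : AddCircle (2 * A)) = x₁) :
    γ = rotate ((b / (2 * π) : ℝ) : LoopCircle) (parallel A x₁) := by
  ext1 z
  induction z using QuotientAddGroup.induction_on with
  | H t =>
    have e : rotate ((b / (2 * π) : ℝ) : LoopCircle) (parallel A x₁) (t : LoopCircle) =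
      parallel A x₁ ((t + b / (2 * π) : ℝ) : LoopCircle) := rfl
    have e' := hc.2 t
    change γ (t : LoopCircle) = rotate ((b / (2 * π) : ℝ) : LoopCircle) (parallel A x₁)
      (t : LoopCircle)
    rw [e', e, (isLift_parallel A x₁).2]
    simp only [cover, h0, h1, hx, Matrix.cons_val_zero, Matrix.cons_val_one]
    congr 2
    field_simp

/-! ### The Hessian of the energy at a parallel -/

/-- Differentiation under the integral sign for the integrands that occur in the energy. -/
theorem hasDerivAt_integral_mul_comp {M : ℝ → ℝ} (hM : ContDiff ℝ 1 M)
    {h a p α₁ β₁ α₂ β₂ : ℝ → ℝ} (hh : ContinuousOn h (Icc 0 1)) (ha : ContinuousOn a (Icc 0 1))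
    (hp : ContinuousOn p (Icc 0 1))
    (hα₁ : MemLp α₁ 2 (volume.restrict (Ioc (0 : ℝ) 1)))
    (hβ₁ : MemLp β₁ 2 (volume.restrict (Ioc (0 : ℝ) 1)))
    (hα₂ : MemLp α₂ 2 (volume.restrict (Ioc (0 : ℝ) 1)))
    (hβ₂ : MemLp β₂ 2 (volume.restrict (Ioc (0 : ℝ) 1))) :
    (∀ u : ℝ, IntervalIntegrable (fun t => h t * M (p t + u * a t) *
      ((α₁ t + u * β₁ t) * (α₂ t + u * β₂ t))) volume 0 1) ∧
    HasDerivAt (fun u => ∫ t in (0 : ℝ)..1, h t * M (p t + u * a t) *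
        ((α₁ t + u * β₁ t) * (α₂ t + u * β₂ t)))
      (∫ t in (0 : ℝ)..1, h t * (deriv M (p t) * a t * (α₁ t * α₂ t) +
        M (p t) * (β₁ t * α₂ t + α₁ t * β₂ t))) 0 := by
  have hM' : Continuous (deriv M) := hM.continuous_deriv le_rfl
  have cM : ∀ {N : ℝ → ℝ}, Continuous N → ∀ u : ℝ,
      ContinuousOn (fun t => N (p t + u * a t)) (Icc 0 1) := fun hN u =>
    hN.comp_continuousOn (hp.add (continuousOn_const.mul ha))
  have meas : ∀ {N : ℝ → ℝ}, ContinuousOn N (Icc 0 1) →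
      AEStronglyMeasurable N (volume.restrict (Ioc (0 : ℝ) 1)) := fun hN =>
    (hN.mono Ioc_subset_Icc_self).aestronglyMeasurable measurableSet_Ioc
  have hL : ∀ u : ℝ, Integrable (fun t => (α₁ t + u * β₁ t) * (α₂ t + u * β₂ t))
      (volume.restrict (Ioc (0 : ℝ) 1)) := fun u =>
    MemLp.integrable_mul (hα₁.add (hβ₁.const_mul u)) (hα₂.add (hβ₂.const_mul u))
  have cfst : ∀ {N : ℝ → ℝ}, ContinuousOn N (Icc 0 1) →
      ContinuousOn (fun q : ℝ × ℝ => N q.1) (Icc (0 : ℝ) 1 ×ˢ Icc (-1 : ℝ) 1) := fun hN =>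
    hN.comp continuousOn_fst fun q hq => hq.1
  have cpa : ContinuousOn (fun q : ℝ × ℝ => p q.1 + q.2 * a q.1)
      (Icc (0 : ℝ) 1 ×ˢ Icc (-1 : ℝ) 1) := (cfst hp).add (continuousOn_snd.mul (cfst ha))
  obtain ⟨C, hC⟩ := (isCompact_Icc.prod isCompact_Icc).exists_bound_of_continuousOn
    ((cfst hh).mul (hM.continuous.comp_continuousOn cpa))
  obtain ⟨D, hD⟩ := (isCompact_Icc.prod isCompact_Icc).exists_bound_of_continuousOn
    ((cfst hh).mul ((hM'.comp_continuousOn cpa).mul (cfst ha)))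
  have hint : ∀ u : ℝ, Integrable (fun t => h t * M (p t + u * a t) *
      ((α₁ t + u * β₁ t) * (α₂ t + u * β₂ t))) (volume.restrict (Ioc (0 : ℝ) 1)) := by
    intro u
    obtain ⟨K, hK⟩ := isCompact_Icc.exists_bound_of_continuousOn (hh.mul (cM hM.continuous u))
    refine (hL u).bdd_mul (meas (hh.mul (cM hM.continuous u))) (c := K) ?_
    exact (ae_restrict_iff' measurableSet_Ioc).2
      (Eventually.of_forall fun t ht => hK t (Ioc_subset_Icc_self ht))
  refine ⟨fun u => (intervalIntegrable_iff_integrableOn_Ioc_of_le zero_le_one).2 (hint u), ?_⟩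
  simp only [intervalIntegral.integral_of_le (zero_le_one (α := ℝ))]
  have hB : Integrable (fun t => (|D| + 2 * |C|) * ((|α₁ t| + |β₁ t|) * (|α₂ t| + |β₂ t|)))
      (volume.restrict (Ioc (0 : ℝ) 1)) :=
    (MemLp.integrable_mul (hα₁.abs.add hβ₁.abs) (hα₂.abs.add hβ₂.abs)).const_mul _
  have key := hasDerivAt_integral_of_dominated_loc_of_deriv_le
    (μ := volume.restrict (Ioc (0 : ℝ) 1)) (x₀ := (0 : ℝ))
    (F := fun u t => h t * M (p t + u * a t) * ((α₁ t + u * β₁ t) * (α₂ t + u * β₂ t)))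
    (F' := fun u t => h t * (deriv M (p t + u * a t) * a t) *
        ((α₁ t + u * β₁ t) * (α₂ t + u * β₂ t)) + h t * M (p t + u * a t) *
        (β₁ t * (α₂ t + u * β₂ t) + (α₁ t + u * β₁ t) * β₂ t))
    (Ioo_mem_nhds (by norm_num : (-1 : ℝ) < 0) zero_lt_one)
    (Eventually.of_forall fun u => (hint u).aestronglyMeasurable) (hint 0) ?_ ?_ hB ?_
  · refine key.2.congr_deriv (integral_congr_ae (Eventually.of_forall fun t => ?_))
    simp only [zero_mul, add_zero]
    ring
  · have m1 := hα₁.aestronglyMeasurable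
    have m2 := hα₂.aestronglyMeasurable
    have m3 := hβ₁.aestronglyMeasurable
    have m4 := hβ₂.aestronglyMeasurable
    exact ((meas (hh.mul ((cM hM' 0).mul ha))).mul (hL 0).aestronglyMeasurable).add
      ((meas (hh.mul (cM hM.continuous 0))).mul ((m3.mul (m2.add (m4.const_mul 0))).add
        ((m1.add (m3.const_mul 0)).mul m4)))
  · refine (ae_restrict_iff' measurableSet_Ioc).2 (Eventually.of_forall fun t ht u hu => ?_)
    have hmem : ((t, u) : ℝ × ℝ) ∈ Icc (0 : ℝ) 1 ×ˢ Icc (-1 : ℝ) 1 :=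
      ⟨Ioc_subset_Icc_self ht, Ioo_subset_Icc_self hu⟩
    have b1 : |h t * M (p t + u * a t)| ≤ |C| := (hC _ hmem).trans (le_abs_self C)
    have b2 : |h t * (deriv M (p t + u * a t) * a t)| ≤ |D| := (hD _ hmem).trans (le_abs_self D)
    have hu1 : |u| ≤ 1 := abs_le.2 ⟨hu.1.le, hu.2.le⟩
    have b3 : ∀ x y : ℝ, |x + u * y| ≤ |x| + |y| := fun x y => by
      refine (abs_add_le _ _).trans ?_
      rw [abs_mul]
      nlinarith [abs_nonneg y]
    have d1 : |(α₁ t + u * β₁ t) * (α₂ t + u * β₂ t)| ≤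
        (|α₁ t| + |β₁ t|) * (|α₂ t| + |β₂ t|) := by
      rw [abs_mul]; exact mul_le_mul (b3 _ _) (b3 _ _) (abs_nonneg _) (by positivity)
    have d2 : |β₁ t * (α₂ t + u * β₂ t)| ≤ (|α₁ t| + |β₁ t|) * (|α₂ t| + |β₂ t|) := by
      rw [abs_mul]
      exact mul_le_mul (by linarith [abs_nonneg (α₁ t)]) (b3 _ _) (abs_nonneg _) (by positivity)
    have d3 : |(α₁ t + u * β₁ t) * β₂ t| ≤ (|α₁ t| + |β₁ t|) * (|α₂ t| + |β₂ t|) := by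
      rw [abs_mul]
      exact mul_le_mul (b3 _ _) (by linarith [abs_nonneg (α₂ t)]) (abs_nonneg _) (by positivity)
    rw [norm_eq_abs]
    refine (abs_add_le _ _).trans ?_
    rw [abs_mul _ ((α₁ t + u * β₁ t) * (α₂ t + u * β₂ t)), abs_mul (h t * M _)]
    have e1 := mul_le_mul b2 d1 (abs_nonneg _) (abs_nonneg D)
    have e2 := mul_le_mul b1 ((abs_add_le _ _).trans (add_le_add d2 d3)) (abs_nonneg _)
      (abs_nonneg C)
    linarith
  · refine Eventually.of_forall fun t u _ => ?_
    have l : ∀ x y : ℝ, HasDerivAt (fun u => x + u * y) y u := fun x y => by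
      simpa using ((hasDerivAt_id u).mul_const y).const_add x
    have hMd : HasDerivAt M (deriv M (p t + u * a t)) (p t + u * a t) :=
      (hM.differentiable one_ne_zero).differentiableAt.hasDerivAt
    have := ((hMd.comp u (l (p t) (a t))).const_mul (h t)).mul
      ((l (α₁ t) (β₁ t)).mul (l (α₂ t) (β₂ t)))
    exact this

/-- The components of a `W^{1,2}` field are integrals of the components of one square-integrable
function `v`. -/
theorem exists_isSobolevPair {ξ : ℝ → Plane} (hξ : ξ ∈ sobolevFields) :
    ∃ v : ℝ → Plane, (∀ i, IsSobolevPair (fun t => ξ t i) (fun t => v t i)) ∧ ξ 1 = ξ 0 := by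
  obtain ⟨hper, v, hv, hξv⟩ := hξ
  refine ⟨v, fun i => ⟨memLp_pi_iff.1 hv i, fun t ht => ?_⟩, by simpa using hper 0⟩
  have hvi : IntervalIntegrable v volume 0 t := by
    have h : IntegrableOn v (Ioc 0 1) volume := hv.integrable (by norm_num)
    exact (intervalIntegrable_iff_integrableOn_Ioc_of_le ht.1).2
      (h.mono_set (Ioc_subset_Ioc_right ht.2))
  have := ContinuousLinearMap.intervalIntegral_comp_comm
    (ContinuousLinearMap.proj (R := ℝ) (φ := fun _ : Fin 2 => ℝ) i) hvi
  simp only [ContinuousLinearMap.proj_apply] at this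
  rw [this, hξv t ht]
  rfl

/-- A periodic field with `W^{1,2}` components is a `W^{1,2}` field. -/
theorem mem_sobolevFields {ξ v : ℝ → Plane} (hper : Function.Periodic ξ 1)
    (h : ∀ i, IsSobolevPair (fun t => ξ t i) (fun t => v t i)) : ξ ∈ sobolevFields := by
  have hv : MemLp v 2 (volume.restrict (Ioc (0 : ℝ) 1)) := memLp_pi_iff.2 fun i => (h i).memLp
  refine ⟨hper, v, hv, fun t ht => ?_⟩
  have hvi : IntervalIntegrable v volume 0 t := by
    have h : IntegrableOn v (Ioc 0 1) volume := hv.integrable (by norm_num)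
    exact (intervalIntegrable_iff_integrableOn_Ioc_of_le ht.1).2
      (h.mono_set (Ioc_subset_Ioc_right ht.2))
  ext i
  have := ContinuousLinearMap.intervalIntegral_comp_comm
    (ContinuousLinearMap.proj (R := ℝ) (φ := fun _ : Fin 2 => ℝ) i) hvi
  simp only [ContinuousLinearMap.proj_apply] at this
  rw [(h i).eq_integral t ht, this]
  rfl

variable {E G : ℝ → ℝ} {ξ η v w : ℝ → Plane}

/-- The energy near a parallel. The integrand is arranged in the form to which
`hasDerivAt_integral_mul_comp` applies. -/
theorem energy_parallel_add (x₀ : ℝ)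
    (hξ : ∀ i, IsSobolevPair (fun t => ξ t i) (fun t => v t i))
    (hη : ∀ i, IsSobolevPair (fun t => η t i) (fun t => w t i)) (s r : ℝ) :
    energy (diagMetric E G) ((fun t => ![x₀, 2 * π * t]) + s • ξ + r • η) =
      1 / 2 * ∫ t in (0 : ℝ)..1,
        (1 * E ((x₀ + r * η t 0) + s * ξ t 0) *
          ((r * w t 0 + s * v t 0) * (r * w t 0 + s * v t 0)) +
        1 * G ((x₀ + r * η t 0) + s * ξ t 0) *
          (((2 * π + r * w t 1) + s * v t 1) * ((2 * π + r * w t 1) + s * v t 1))) := by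
  rw [energy]
  congr 1
  refine intervalIntegral.integral_congr_ae ?_
  filter_upwards [(hξ 0).ae_hasDerivAt, (hξ 1).ae_hasDerivAt, (hη 0).ae_hasDerivAt,
    (hη 1).ae_hasDerivAt] with t h1 h2 h3 h4 hmem
  rw [uIoc_of_le zero_le_one] at hmem
  have hd : HasDerivAt ((fun t => ![x₀, 2 * π * t]) + s • ξ + r • η)
      ![r * w t 0 + s * v t 0, (2 * π + r * w t 1) + s * v t 1] t := by
    rw [hasDerivAt_pi]
    intro i
    fin_cases i
    · exact ((((h1 hmem).const_mul s).const_add x₀).add ((h3 hmem).const_mul r)).congr_deriv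
        (add_comm _ _)
    · refine (((((hasDerivAt_id t).const_mul (2 * π))).add ((h2 hmem).const_mul s)).add
        ((h4 hmem).const_mul r)).congr_deriv ?_
      change 2 * π * 1 + s * v t 1 + r * w t 1 = 2 * π + r * w t 1 + s * v t 1
      ring
  rw [hd.deriv, dotProduct_diagMetric]
  simp only [Pi.add_apply, Pi.smul_apply, smul_eq_mul, Matrix.cons_val_zero, Matrix.cons_val_one]
  rw [show x₀ + s * ξ t 0 + r * η t 0 = (x₀ + r * η t 0) + s * ξ t 0 by ring]
  ring

/-- The first variation of the energy at the parallel displaced by `r • η`, as a function of `r` to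
which `hasDerivAt_integral_mul_comp` applies again. -/
theorem deriv_energy_parallel (hE : ContDiff ℝ ∞ E) (hG : ContDiff ℝ ∞ G) (x₀ : ℝ)
    (hξ : ∀ i, IsSobolevPair (fun t => ξ t i) (fun t => v t i))
    (hη : ∀ i, IsSobolevPair (fun t => η t i) (fun t => w t i)) (r : ℝ) :
    deriv (fun s : ℝ =>
        energy (diagMetric E G) ((fun t => ![x₀, 2 * π * t]) + s • ξ + r • η)) 0 =
      1 / 2 * (∫ t in (0 : ℝ)..1, ξ t 0 * deriv E (x₀ + r * η t 0) *
          ((0 + r * w t 0) * (0 + r * w t 0))) +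
        (∫ t in (0 : ℝ)..1, 1 * E (x₀ + r * η t 0) * ((0 + r * w t 0) * (v t 0 + r * 0))) +
        1 / 2 * (∫ t in (0 : ℝ)..1, ξ t 0 * deriv G (x₀ + r * η t 0) *
          ((2 * π + r * w t 1) * (2 * π + r * w t 1))) +
        ∫ t in (0 : ℝ)..1, 1 * G (x₀ + r * η t 0) * ((2 * π + r * w t 1) * (v t 1 + r * 0)) := by
  have hE' : ContDiff ℝ 1 (deriv E) := (hE.iterate_deriv 1).of_le (by simp)
  have hG' : ContDiff ℝ 1 (deriv G) := (hG.iterate_deriv 1).of_le (by simp)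
  have hE1 : ContDiff ℝ 1 E := hE.of_le (by simp)
  have hG1 : ContDiff ℝ 1 G := hG.of_le (by simp)
  have cx : ContinuousOn (fun _ : ℝ => x₀) (Icc 0 1) := continuousOn_const
  have c1 : ContinuousOn (fun _ : ℝ => (1 : ℝ)) (Icc 0 1) := continuousOn_const
  have cη := (hη 0).continuousOn
  have cξ := (hξ 0).continuousOn
  have cp : ContinuousOn (fun t => x₀ + r * η t 0) (Icc 0 1) := cx.add (continuousOn_const.mul cη)
  have m0 : MemLp (fun t => r * w t 0) 2 (volume.restrict (Ioc (0 : ℝ) 1)) :=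
    (hη 0).memLp.const_mul r
  have m1 : MemLp (fun t => 2 * π + r * w t 1) 2 (volume.restrict (Ioc (0 : ℝ) 1)) :=
    (memLp_const (2 * π)).add ((hη 1).memLp.const_mul r)
  have mz : MemLp (fun _ : ℝ => (0 : ℝ)) 2 (volume.restrict (Ioc (0 : ℝ) 1)) := memLp_const 0
  have mp : MemLp (fun _ : ℝ => 2 * π) 2 (volume.restrict (Ioc (0 : ℝ) 1)) := memLp_const _
  have dE := hasDerivAt_integral_mul_comp hE1 c1 cξ cp m0 (hξ 0).memLp m0 (hξ 0).memLp
  have dG := hasDerivAt_integral_mul_comp hG1 c1 cξ cp m1 (hξ 1).memLp m1 (hξ 1).memLp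
  have i1 := (hasDerivAt_integral_mul_comp hE' cξ cη cx mz (hη 0).memLp mz (hη 0).memLp).1 r
  have i2 := (hasDerivAt_integral_mul_comp hE1 c1 cη cx mz (hη 0).memLp (hξ 0).memLp mz).1 r
  have i3 := (hasDerivAt_integral_mul_comp hG' cξ cη cx mp (hη 1).memLp mp (hη 1).memLp).1 r
  have i4 := (hasDerivAt_integral_mul_comp hG1 c1 cη cx mp (hη 1).memLp (hξ 1).memLp mz).1 r
  have key := ((dE.2.add dG.2).const_mul (1 / 2)).deriv
  have e : (fun s : ℝ =>
      energy (diagMetric E G) ((fun t => ![x₀, 2 * π * t]) + s • ξ + r • η)) =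
      fun s => 1 / 2 * ((∫ t in (0 : ℝ)..1, 1 * E ((x₀ + r * η t 0) + s * ξ t 0) *
          ((r * w t 0 + s * v t 0) * (r * w t 0 + s * v t 0))) +
        ∫ t in (0 : ℝ)..1, 1 * G ((x₀ + r * η t 0) + s * ξ t 0) *
          (((2 * π + r * w t 1) + s * v t 1) * ((2 * π + r * w t 1) + s * v t 1))) := by
    funext s
    rw [energy_parallel_add x₀ hξ hη, intervalIntegral.integral_add (dE.1 s) (dG.1 s)]
  rw [e]
  refine key.trans ?_
  have s1 : ∀ {N : ℝ → ℝ} {α β : ℝ → ℝ},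
      IntervalIntegrable (fun t => ξ t 0 * deriv N (x₀ + r * η t 0) * (α t * α t)) volume 0 1 →
      IntervalIntegrable (fun t => 1 * N (x₀ + r * η t 0) * (α t * (β t + r * 0))) volume 0 1 →
      ∫ t in (0 : ℝ)..1, 1 * (deriv N (x₀ + r * η t 0) * ξ t 0 * (α t * α t) +
        N (x₀ + r * η t 0) * (β t * α t + α t * β t)) =
      (∫ t in (0 : ℝ)..1, ξ t 0 * deriv N (x₀ + r * η t 0) * (α t * α t)) +
        2 * ∫ t in (0 : ℝ)..1, 1 * N (x₀ + r * η t 0) * (α t * (β t + r * 0)) := by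
    intro N α β h1 h2
    rw [← intervalIntegral.integral_const_mul, ← intervalIntegral.integral_add h1 (h2.const_mul 2)]
    refine intervalIntegral.integral_congr fun t _ => ?_
    ring
  simp only [zero_add] at i1 i2 ⊢
  rw [s1 i1 i2, s1 i3 i4]
  ring

/-- The Hessian of the energy at a parallel where `G' = 0`, that is, one which is a geodesic. -/
theorem hessian_parallel (hE : ContDiff ℝ ∞ E) (hG : ContDiff ℝ ∞ G) {x₀ : ℝ}
    (hx : deriv G x₀ = 0)
    (hξ : ∀ i, IsSobolevPair (fun t => ξ t i) (fun t => v t i))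
    (hη : ∀ i, IsSobolevPair (fun t => η t i) (fun t => w t i)) :
    hessian (diagMetric E G) (fun t => ![x₀, 2 * π * t]) ξ η =
      E x₀ * (∫ t in (0 : ℝ)..1, v t 0 * w t 0) +
        2 * π ^ 2 * deriv (deriv G) x₀ * (∫ t in (0 : ℝ)..1, ξ t 0 * η t 0) +
        G x₀ * ∫ t in (0 : ℝ)..1, v t 1 * w t 1 := by
  have hE' : ContDiff ℝ 1 (deriv E) := (hE.iterate_deriv 1).of_le (by simp)
  have hG' : ContDiff ℝ 1 (deriv G) := (hG.iterate_deriv 1).of_le (by simp)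
  have hE1 : ContDiff ℝ 1 E := hE.of_le (by simp)
  have hG1 : ContDiff ℝ 1 G := hG.of_le (by simp)
  have cx : ContinuousOn (fun _ : ℝ => x₀) (Icc 0 1) := continuousOn_const
  have c1 : ContinuousOn (fun _ : ℝ => (1 : ℝ)) (Icc 0 1) := continuousOn_const
  have cη := (hη 0).continuousOn
  have cξ := (hξ 0).continuousOn
  have mz : MemLp (fun _ : ℝ => (0 : ℝ)) 2 (volume.restrict (Ioc (0 : ℝ) 1)) := memLp_const 0
  have mp : MemLp (fun _ : ℝ => 2 * π) 2 (volume.restrict (Ioc (0 : ℝ) 1)) := memLp_const _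
  have d1 := (hasDerivAt_integral_mul_comp hE' cξ cη cx mz (hη 0).memLp mz (hη 0).memLp).2
  have d2 := (hasDerivAt_integral_mul_comp hE1 c1 cη cx mz (hη 0).memLp (hξ 0).memLp mz).2
  have d3 := (hasDerivAt_integral_mul_comp hG' cξ cη cx mp (hη 1).memLp mp (hη 1).memLp).2
  have d4 := (hasDerivAt_integral_mul_comp hG1 c1 cη cx mp (hη 1).memLp (hξ 1).memLp mz).2
  rw [hessian]
  simp only [deriv_energy_parallel hE hG x₀ hξ hη]
  refine ((((d1.const_mul (1 / 2)).add d2).add (d3.const_mul (1 / 2))).add d4).deriv.trans ?_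
  simp only [← intervalIntegral.integral_const_mul, hx]
  have e1 : ∀ t : ℝ, 1 / 2 * (ξ t 0 * (deriv (deriv E) x₀ * η t 0 * (0 * 0) +
    deriv E x₀ * (w t 0 * 0 + 0 * w t 0))) = 0 := fun t => by ring
  simp only [e1, intervalIntegral.integral_zero, zero_add]
  congr 1
  · congr 1
    · refine intervalIntegral.integral_congr fun t _ => ?_
      ring
    · refine intervalIntegral.integral_congr fun t _ => ?_
      ring
  · refine intervalIntegral.integral_congr fun t _ => ?_
    ring

/-! ### Index and nullity of a parallel -/

namespace IsSobolevPair

theorem const (a : ℝ) : IsSobolevPair (fun _ => a) fun _ => 0 :=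
  ⟨memLp_const 0, fun t _ => by simp⟩

theorem sub_const {u v : ℝ → ℝ} (h : IsSobolevPair u v) (a : ℝ) :
    IsSobolevPair (fun t => u t - a) v :=
  ⟨h.memLp, fun t ht => by rw [h.eq_integral t ht]; ring⟩

end IsSobolevPair

theorem eq_zero_of_integral_sq_eq_zero {u : ℝ → ℝ} (hu : ContinuousOn u (Icc 0 1))
    (h : ∫ t in (0 : ℝ)..1, u t ^ 2 ≤ 0) {t : ℝ} (ht : t ∈ Icc (0 : ℝ) 1) : u t = 0 := by
  by_contra hne
  have := intervalIntegral.integral_pos (f := fun t => u t ^ 2) zero_lt_one (hu.pow 2)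
    (fun x _ => sq_nonneg _) ⟨t, ht, by positivity⟩
  linarith

theorem integral_sq_nonneg (u : ℝ → ℝ) : 0 ≤ ∫ t in (0 : ℝ)..1, u t ^ 2 :=
  intervalIntegral.integral_nonneg zero_le_one fun _ _ => sq_nonneg _

/-- By Wirtinger's inequality a periodic `W^{1,2}` function with vanishing derivative is constant. -/
theorem IsSobolevPair.eq_const {u v : ℝ → ℝ} (h : IsSobolevPair u v) (hper : u 1 = u 0)
    (hv : ∫ t in (0 : ℝ)..1, v t ^ 2 ≤ 0) {t : ℝ} (ht : t ∈ Icc (0 : ℝ) 1) : u t = u 0 := by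
  have hi : IntervalIntegrable u volume 0 1 :=
    ContinuousOn.intervalIntegrable_of_Icc zero_le_one h.continuousOn
  set μ := ∫ t in (0 : ℝ)..1, u t
  have hw := wirtinger_inequality (h.sub_const μ) (by simp [hper]) (by
    rw [intervalIntegral.integral_sub hi (by simp)]; simp [μ])
  have hs : ∫ t in (0 : ℝ)..1, (u t - μ) ^ 2 ≤ 0 := by
    have : 0 < (2 * π) ^ 2 := by positivity
    nlinarith
  have h1 := eq_zero_of_integral_sq_eq_zero (h.sub_const μ).continuousOn hs ht
  have h2 := eq_zero_of_integral_sq_eq_zero (h.sub_const μ).continuousOn hs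
    (left_mem_Icc.2 zero_le_one)
  linarith

theorem eq_of_eqOn_Icc {ξ η : ℝ → Plane} (hξ : Function.Periodic ξ 1) (hη : Function.Periodic η 1)
    (h : ∀ t ∈ Icc (0 : ℝ) 1, ξ t = η t) : ξ = η := by
  funext t
  have h1 := hξ.sub_zsmul_eq ⌊t⌋ (x := t)
  have h2 := hη.sub_zsmul_eq ⌊t⌋ (x := t)
  rw [← h1, ← h2]
  refine h _ ?_
  simp only [zsmul_eq_mul, mul_one]
  exact ⟨by linarith [Int.floor_le t], by linarith [Int.lt_floor_add_one t]⟩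

theorem deriv_parallel (x₀ t : ℝ) :
    deriv (fun t => (![x₀, 2 * π * t] : Plane)) t = ![0, 2 * π] := by
  refine HasDerivAt.deriv ?_
  rw [hasDerivAt_pi]
  intro i
  fin_cases i
  · exact hasDerivAt_const t x₀
  · exact ((hasDerivAt_id t).const_mul (2 * π)).congr_deriv (mul_one _)

section

variable {E G : ℝ → ℝ} {x₀ : ℝ}

theorem isSobolevPair_fst {u v : ℝ → ℝ} (h : IsSobolevPair u v) (i : Fin 2) :
    IsSobolevPair (fun t => (![u t, 0] : Plane) i) (fun t => (![v t, 0] : Plane) i) := by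
  fin_cases i
  · exact h
  · exact .const 0

theorem isSobolevPair_snd {u v : ℝ → ℝ} (h : IsSobolevPair u v) (i : Fin 2) :
    IsSobolevPair (fun t => (![0, u t] : Plane) i) (fun t => (![0, v t] : Plane) i) := by
  fin_cases i
  · exact .const 0
  · exact h

/-- The kernel of the Hessian at a parallel is spanned by its velocity, provided that the
form `E(x₀) ∫ u̇² + 2π² G''(x₀) ∫ u²` has no kernel; for this it suffices to consider functions `u`
that are orthogonal, for this form, to the constants and to themselves. -/
theorem isNondegenerate_parallel {A : ℝ} (hE : ContDiff ℝ ∞ E) (hG : ContDiff ℝ ∞ G)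
    (hx : deriv G x₀ = 0) (hGpos : 0 < G x₀)
    (hker : ∀ u v : ℝ → ℝ, IsSobolevPair u v → u 1 = u 0 →
      2 * π ^ 2 * deriv (deriv G) x₀ * (∫ t in (0 : ℝ)..1, u t) = 0 →
      E x₀ * (∫ t in (0 : ℝ)..1, v t ^ 2) +
        2 * π ^ 2 * deriv (deriv G) x₀ * (∫ t in (0 : ℝ)..1, u t ^ 2) = 0 →
      ∫ t in (0 : ℝ)..1, u t ^ 2 ≤ 0)
    (hgeo : IsClosedGeodesic (diagMetric E G) (parallel A x₀)) :
    IsNondegenerate (diagMetric E G) (parallel A x₀) := by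
  refine ⟨hgeo, _, isLift_parallel A x₀, ?_, fun ξ hξ => ⟨fun h => ?_, ?_⟩⟩
  · intro h
    have := congrFun (congrFun h 0) 1
    rw [deriv_parallel] at this
    simp [pi_ne_zero] at this
  · obtain ⟨v, hv, hper⟩ := exists_isSobolevPair hξ
    have hper0 : ∀ i, ξ 1 i = ξ 0 i := fun i => congrFun hper i
    -- test against a constant field and against the two components of `ξ`
    have hconst := h (fun _ => ![1, 0])
      (mem_sobolevFields (fun _ => rfl) (isSobolevPair_fst (.const 1)))
    rw [hessian_parallel hE hG hx hv (isSobolevPair_fst (.const 1))] at hconst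
    have hfst := h (fun t => ![ξ t 0, 0])
      (mem_sobolevFields (fun t => by simp [hξ.1 t]) (isSobolevPair_fst (hv 0)))
    rw [hessian_parallel hE hG hx hv (isSobolevPair_fst (hv 0))] at hfst
    have hsnd := h (fun t => ![0, ξ t 1])
      (mem_sobolevFields (fun t => by simp [hξ.1 t]) (isSobolevPair_snd (hv 1)))
    rw [hessian_parallel hE hG hx hv (isSobolevPair_snd (hv 1))] at hsnd
    simp only [Matrix.cons_val_zero, Matrix.cons_val_one, mul_zero, mul_one,
      intervalIntegral.integral_zero, add_zero, zero_add, ← pow_two] at hconst hfst hsnd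
    have h0 : ∀ t ∈ Icc (0 : ℝ) 1, ξ t 0 = 0 := fun t ht =>
      eq_zero_of_integral_sq_eq_zero (hv 0).continuousOn
        (hker _ _ (hv 0) (hper0 0) hconst hfst) ht
    have h1 : ∀ t ∈ Icc (0 : ℝ) 1, ξ t 1 = ξ 0 1 := fun t ht => by
      refine (hv 1).eq_const (hper0 1) ?_ ht
      rcases mul_eq_zero.1 hsnd with h | h
      · exact absurd h hGpos.ne'
      · exact h.le
    refine ⟨ξ 0 1 / (2 * π), eq_of_eqOn_Icc hξ.1 (fun t => ?_) fun t ht => ?_⟩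
    · simp only [Pi.smul_apply, deriv_parallel]
    · ext i
      have hpi : (2 * π) ≠ 0 := two_pi_pos.ne'
      fin_cases i
      · simp [deriv_parallel, h0 t ht]
      · simp [deriv_parallel, h1 t ht]
  · rintro ⟨a, rfl⟩ η hη
    obtain ⟨w, hw, -⟩ := exists_isSobolevPair hη
    have he : a • deriv (fun t => (![x₀, 2 * π * t] : Plane)) = fun _ => ![0, a * (2 * π)] := by
      funext t
      ext i
      rw [Pi.smul_apply, deriv_parallel]
      fin_cases i <;> simp
    rw [he, hessian_parallel hE hG hx (isSobolevPair_snd (.const _)) hw]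
    simp

theorem hessian_self_parallel (hE : ContDiff ℝ ∞ E) (hG : ContDiff ℝ ∞ G)
    (hx : deriv G x₀ = 0) {ξ v : ℝ → Plane}
    (hv : ∀ i, IsSobolevPair (fun t => ξ t i) (fun t => v t i)) :
    hessian (diagMetric E G) (fun t => ![x₀, 2 * π * t]) ξ ξ =
      E x₀ * (∫ t in (0 : ℝ)..1, v t 0 ^ 2) +
        2 * π ^ 2 * deriv (deriv G) x₀ * (∫ t in (0 : ℝ)..1, ξ t 0 ^ 2) +
        G x₀ * ∫ t in (0 : ℝ)..1, v t 1 ^ 2 := by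
  simp only [hessian_parallel hE hG hx hv hv, pow_two]

/-- The Hessian is positive semidefinite at a minimum of `G`. -/
theorem hasIndex_parallel_zero {A : ℝ} (hE : ContDiff ℝ ∞ E) (hG : ContDiff ℝ ∞ G)
    (hx : deriv G x₀ = 0) (hEpos : 0 < E x₀) (hGpos : 0 < G x₀)
    (hmin : 0 < deriv (deriv G) x₀) :
    HasIndex (diagMetric E G) (parallel A x₀) 0 := by
  refine ⟨_, isLift_parallel A x₀, le_antisymm ?_ zero_le⟩
  refine iSup_le fun V => iSup_le fun hV => iSup_le fun hneg => ?_
  have hbot : V = ⊥ := by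
    refine (Submodule.eq_bot_iff V).2 fun ξ hξ => ?_
    by_contra hne
    obtain ⟨v, hv, -⟩ := exists_isSobolevPair (hV hξ)
    have := hneg ξ hξ hne
    rw [hessian_self_parallel hE hG hx hv] at this
    have i1 := integral_sq_nonneg fun t => v t 0
    have i2 := integral_sq_nonneg fun t => ξ t 0
    have i3 := integral_sq_nonneg fun t => v t 1
    have : 0 ≤ E x₀ * (∫ t in (0 : ℝ)..1, v t 0 ^ 2) +
        2 * π ^ 2 * deriv (deriv G) x₀ * (∫ t in (0 : ℝ)..1, ξ t 0 ^ 2) +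
        G x₀ * ∫ t in (0 : ℝ)..1, v t 1 ^ 2 := by positivity
    linarith
  subst hbot
  simp

/-- By Wirtinger's inequality the Hessian is positive semidefinite on the hyperplane of fields whose
`x`-component has mean zero, so the index is at most one; constant fields show that it is one. -/
theorem hasIndex_parallel_one {A : ℝ} (hE : ContDiff ℝ ∞ E) (hG : ContDiff ℝ ∞ G)
    (hx : deriv G x₀ = 0) (hEpos : 0 < E x₀) (hGpos : 0 < G x₀)
    (hmax : deriv (deriv G) x₀ < 0) (hbound : 0 < 2 * E x₀ + deriv (deriv G) x₀) :
    HasIndex (diagMetric E G) (parallel A x₀) 1 := by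
  refine ⟨_, isLift_parallel A x₀, le_antisymm ?_ ?_⟩
  · refine iSup_le fun V => iSup_le fun hV => iSup_le fun hneg => ?_
    have hint : ∀ ξ ∈ V, IntervalIntegrable (fun t => ξ t 0) volume 0 1 := fun ξ hξ => by
      obtain ⟨v, hv, -⟩ := exists_isSobolevPair (hV hξ)
      exact ContinuousOn.intervalIntegrable_of_Icc zero_le_one (hv 0).continuousOn
    let mean : V →ₗ[ℝ] ℝ :=
      { toFun := fun ξ => ∫ t in (0 : ℝ)..1, ξ.1 t 0
        map_add' := fun ξ η => intervalIntegral.integral_add (hint _ ξ.2) (hint _ η.2)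
        map_smul' := fun a ξ => intervalIntegral.integral_const_mul a _ }
    have hinj : Function.Injective mean := by
      refine (injective_iff_map_eq_zero mean).2 fun ξ hξ => ?_
      by_contra hne
      obtain ⟨v, hv, hper⟩ := exists_isSobolevPair (hV ξ.2)
      have h1 := hneg ξ.1 ξ.2 fun h => hne (Subtype.ext h)
      rw [hessian_self_parallel hE hG hx hv] at h1
      have h2 := wirtinger_inequality (hv 0) (congrFun hper 0) hξ
      have i2 := integral_sq_nonneg fun t => ξ.1 t 0
      have i3 := integral_sq_nonneg fun t => v t 1
      have i4 := mul_le_mul_of_nonneg_left h2 hEpos.le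
      have i5 : 0 ≤ 2 * π ^ 2 * (2 * E x₀ + deriv (deriv G) x₀) *
          ∫ t in (0 : ℝ)..1, ξ.1 t 0 ^ 2 := by positivity
      have i6 := mul_nonneg hGpos.le i3
      linarith
    have := LinearMap.rank_le_of_injective mean hinj
    rw [Module.rank_self] at this
    simpa using Cardinal.toENat.monotone' this
  · -- the constant field `∂ₓ` spans a negative line
    have hpair := isSobolevPair_fst (.const 1)
    have hmem : (fun _ => ![1, 0] : ℝ → Plane) ∈ sobolevFields :=
      mem_sobolevFields (fun _ => rfl) hpair
    have hne : (fun _ => ![1, 0] : ℝ → Plane) ≠ 0 := fun h => by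
      simpa using congrFun (congrFun h 0) 0
    refine le_iSup_of_le (Submodule.span ℝ {(fun _ => ![1, 0] : ℝ → Plane)})
      (le_iSup_of_le ?_ (le_iSup_of_le ?_ ?_))
    · rwa [Submodule.span_singleton_le_iff_mem]
    · intro ξ hξ hne
      obtain ⟨a, rfl⟩ := Submodule.mem_span_singleton.1 hξ
      have ha : a ≠ 0 := by rintro rfl; simp at hne
      have he : a • (fun _ => ![1, 0] : ℝ → Plane) = fun _ => ![a, 0] := by
        funext t
        simp
      rw [he, hessian_self_parallel hE hG hx (isSobolevPair_fst (.const a))]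
      simp
      have := pi_pos
      exact mul_neg_of_neg_of_pos (mul_neg_of_pos_of_neg (by positivity) hmax) (by positivity)
    · have := Module.rank_eq_one_iff_finrank_eq_one.2 (finrank_span_singleton (K := ℝ) hne)
      rw [this]
      simp

end

/-! ### A periodic force that is linear away from the odd integers -/

/-- An odd 2-periodic function equal to `X ↦ k X` on `[-1 + ε, 1 - ε]`. Geodesics will move
according to `X'' = -κ² w(X)`, so that `-w` plays the role of a force. The bound on the
derivative excludes 1-periodic motions with `κ² k < 4π²`, other than the equilibria, which are the
integers. -/
structure IsForce (k ε : ℝ) (w : ℝ → ℝ) : Prop where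
  smooth : ContDiff ℝ ∞ w
  odd : ∀ x, w (-x) = -w x
  periodic : Function.Periodic w 2
  deriv_le : ∀ x, deriv w x ≤ k
  eq_linear : ∀ x ∈ Icc (-1 + ε) (1 - ε), w x = k * x
  pos : ∀ x ∈ Ioo (0 : ℝ) 1, 0 < w x
  le_linear : ∀ x ∈ Icc (0 : ℝ) 1, w x ≤ k * x
  deriv_one : deriv w 1 < 0

/-- A smooth function of `cos (π x)`, hence even and 2-periodic, supported where `x` is within `ε`
of an odd integer. -/
def bump (ε x : ℝ) : ℝ := expNegInvGlue (-cos (π * x) - cos (π * ε))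

section bump

variable {ε : ℝ}

theorem bump_contDiff : ContDiff ℝ ∞ (bump ε) :=
  expNegInvGlue.contDiff.comp
    (((contDiff_cos.comp (contDiff_const.mul contDiff_id)).neg).sub contDiff_const)

theorem bump_neg (x : ℝ) : bump ε (-x) = bump ε x := by
  simp [bump]

theorem bump_periodic : Function.Periodic (bump ε) 2 := fun x => by
  simp only [bump]
  rw [show π * (x + 2) = π * x + 2 * π by ring, cos_add_two_pi]

theorem bump_nonneg (x : ℝ) : 0 ≤ bump ε x := expNegInvGlue.nonneg _

theorem bump_eq_zero (h0 : 0 < ε) {x : ℝ} (hx : x ∈ Icc (-1 + ε) (1 - ε)) : bump ε x = 0 := by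
  refine expNegInvGlue.zero_of_nonpos ?_
  have h1 : |π * x| ≤ π * (1 - ε) := by
    rw [abs_mul, abs_of_pos pi_pos]
    exact mul_le_mul_of_nonneg_left (abs_le.2 ⟨by linarith [hx.1], hx.2⟩) pi_pos.le
  have h2 : cos (π * (1 - ε)) ≤ cos (π * x) := by
    rw [← cos_abs (π * x)]
    exact cos_le_cos_of_nonneg_of_le_pi (abs_nonneg _) (by nlinarith [pi_pos]) h1
  rw [show π * (1 - ε) = π - π * ε by ring, cos_pi_sub] at h2
  linarith

theorem bump_one_pos (h0 : 0 < ε) (h1 : ε < 1) : 0 < bump ε 1 := by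
  refine expNegInvGlue.pos_of_pos ?_
  have : cos (π * ε) < cos 0 :=
    cos_lt_cos_of_nonneg_of_le_pi le_rfl (by nlinarith [pi_pos]) (by positivity)
  simp at this ⊢
  exact this

theorem bump_monotoneOn : MonotoneOn (bump ε) (Icc 0 1) := fun x hx y hy hxy => by
  refine expNegInvGlue.monotone ?_
  have : cos (π * y) ≤ cos (π * x) :=
    cos_le_cos_of_nonneg_of_le_pi (mul_nonneg pi_pos.le hx.1)
      (by nlinarith [pi_pos, hy.2]) (mul_le_mul_of_nonneg_left hxy pi_pos.le)
  linarith

end bump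

/-- The derivative of `w` is `k (1 - B)` with a bump `B ≥ 0` of integral `1` over `[0, 1]`; this
makes `w` vanish at `1`, hence periodic. As `B` increases on `[0, 1]`, `w` is concave there. -/
theorem exists_isForce {k ε : ℝ} (hk : 0 < k) (h0 : 0 < ε) (h1 : ε < 1) :
    ∃ w, IsForce k ε w := by
  have bc : Continuous (bump ε) := bump_contDiff.continuous
  have hI : 0 < ∫ x in (0 : ℝ)..1, bump ε x :=
    intervalIntegral.integral_pos zero_lt_one bc.continuousOn (fun x _ => bump_nonneg x)
      ⟨1, right_mem_Icc.2 zero_le_one, bump_one_pos h0 h1⟩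
  set I := ∫ x in (0 : ℝ)..1, bump ε x with hIdef
  -- the normalised bump
  set B : ℝ → ℝ := fun x => I⁻¹ * bump ε x with hB
  have Bsm : ContDiff ℝ ∞ B := contDiff_const.mul bump_contDiff
  have Bc : Continuous B := Bsm.continuous
  have Bi : ∀ a b, IntervalIntegrable B volume a b := fun a b => Bc.intervalIntegrable a b
  have Bneg : ∀ x, B (-x) = B x := fun x => by simp only [hB, bump_neg]
  have Bper : Function.Periodic B 2 := fun x => by simp only [hB, bump_periodic x]
  have B0 : ∀ x, 0 ≤ B x := fun x => mul_nonneg (inv_nonneg.2 hI.le) (bump_nonneg x)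
  have Bz : ∀ x ∈ Icc (-1 + ε) (1 - ε), B x = 0 := fun x hx => by
    simp only [hB, bump_eq_zero h0 hx, mul_zero]
  have Bmono : MonotoneOn B (Icc 0 1) := fun x hx y hy hxy =>
    mul_le_mul_of_nonneg_left (bump_monotoneOn hx hy hxy) (inv_nonneg.2 hI.le)
  have Bint : ∫ x in (0 : ℝ)..1, B x = 1 := by
    rw [intervalIntegral.integral_const_mul, ← hIdef, inv_mul_cancel₀ hI.ne']
  have Bat0 : B 0 = 0 := Bz 0 ⟨by linarith, by linarith⟩
  have hd : ∀ x, HasDerivAt (fun x => k * (x - ∫ t in (0 : ℝ)..x, B t)) (k * (1 - B x)) x :=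
    fun x => ((hasDerivAt_id x).sub (intervalIntegral.integral_hasDerivAt_right (Bi 0 x)
      (Bc.stronglyMeasurableAtFilter _ _) Bc.continuousAt)).const_mul k
  have hderiv : deriv (fun x => k * (x - ∫ t in (0 : ℝ)..x, B t)) = fun x => k * (1 - B x) :=
    funext fun x => (hd x).deriv
  -- while `B ≤ 1` on `[0, x]`, the integral of `B` stays below `x`, since `B 0 = 0`
  have hlt : ∀ x ∈ Ioc (0 : ℝ) 1, B x ≤ 1 → ∫ t in (0 : ℝ)..x, B t < x := fun x hx hBx => by
    have := intervalIntegral.integral_lt_integral_of_continuousOn_of_le_of_exists_lt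
      (f := B) (g := fun _ => 1) hx.1 Bc.continuousOn continuousOn_const
      (fun t ht => (Bmono ⟨ht.1.le, ht.2.trans hx.2⟩ ⟨hx.1.le, hx.2⟩ ht.2).trans hBx)
      ⟨0, left_mem_Icc.2 hx.1.le, by rw [Bat0]; exact zero_lt_one⟩
    simpa using this
  have hB1 : 1 < B 1 := by
    by_contra! h
    exact absurd (hlt 1 (right_mem_Ioc.2 zero_lt_one) h) (by rw [Bint]; exact lt_irrefl _)
  have hneg : ∀ x, ∫ t in (0 : ℝ)..(-x), B t = -∫ t in (0 : ℝ)..x, B t := fun x => by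
    have := intervalIntegral.integral_comp_neg (a := 0) (b := x) B
    simp only [Bneg, neg_zero] at this
    rw [this, intervalIntegral.integral_symm]
  refine ⟨fun x => k * (x - ∫ t in (0 : ℝ)..x, B t), ⟨?_, ?_, ?_, ?_, ?_, ?_, ?_, ?_⟩⟩
  · rw [contDiff_infty_iff_deriv]
    refine ⟨fun x => (hd x).differentiableAt, ?_⟩
    rw [hderiv]
    exact contDiff_const.mul (contDiff_const.sub Bsm)
  · intro x
    simp only [hneg]
    ring
  · intro x
    have e1 : ∫ t in x..(x + 2), B t = ∫ t in (-1 : ℝ)..(-1 + 2), B t :=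
      Bper.intervalIntegral_add_eq x (-1)
    have e2 := intervalIntegral.integral_add_adjacent_intervals (Bi 0 x) (Bi x (x + 2))
    have e3 := intervalIntegral.integral_add_adjacent_intervals (Bi (-1) 0) (Bi 0 1)
    have e4 := hneg 1
    rw [intervalIntegral.integral_symm] at e4
    norm_num at e1
    simp only
    rw [← e2, e1, ← e3, show ∫ t in (-1 : ℝ)..0, B t = 1 by linarith, Bint]
    ring
  · intro x
    rw [hderiv]
    nlinarith [B0 x]
  · intro x hx
    have : ∫ t in (0 : ℝ)..x, B t = 0 := by
      refine (intervalIntegral.integral_congr (g := fun _ => 0) fun t ht => Bz t ?_).trans (by simp)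
      have := uIcc_subset_Icc (a₂ := (-1 + ε)) (b₂ := 1 - ε) ⟨by linarith, by linarith⟩ hx ht
      exact this
    simp only [this, sub_zero]
  · intro x hx
    refine mul_pos hk (sub_pos.2 ?_)
    rcases le_or_gt (B x) 1 with h | h
    · exact hlt x ⟨hx.1, hx.2.le⟩ h
    · have e1 := intervalIntegral.integral_add_adjacent_intervals (Bi 0 x) (Bi x 1)
      have e2 : ∫ _ in x..1, B x ≤ ∫ t in x..1, B t :=
        intervalIntegral.integral_mono_on hx.2.le (by simp) (Bi _ _) fun t ht =>
          Bmono ⟨hx.1.le, hx.2.le⟩ ⟨hx.1.le.trans ht.1, ht.2⟩ ht.1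
      simp only [intervalIntegral.integral_const, smul_eq_mul] at e2
      rw [Bint] at e1
      nlinarith [hx.2]
  · intro x hx
    have : 0 ≤ ∫ t in (0 : ℝ)..x, B t := intervalIntegral.integral_nonneg hx.1 fun t _ => B0 t
    nlinarith
  · rw [hderiv]
    nlinarith

/-! ### The profile with prescribed potential -/

/-- `[0, 1]` is a fundamental domain for the group generated by `x ↦ -x` and `x ↦ x + 2`. -/
theorem exists_mem_Icc_of_two_periodic (x : ℝ) :
    ∃ y ∈ Icc (0 : ℝ) 1, ∃ n : ℤ, x = y + n * 2 ∨ x = -y + n * 2 := by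
  have h1 := Int.floor_le ((x + 1) / 2)
  have h2 := Int.lt_floor_add_one ((x + 1) / 2)
  set n := ⌊(x + 1) / 2⌋
  rcases le_total 0 (x - n * 2) with h | h
  · exact ⟨x - n * 2, ⟨h, by linarith⟩, n, Or.inl (by ring)⟩
  · exact ⟨-(x - n * 2), ⟨by linarith, by linarith⟩, n, Or.inr (by ring)⟩

/-- Twice the potential energy of the force field `x ↦ -w x`, normalised by the value `m` at `0`. -/
def potential (m : ℝ) (w : ℝ → ℝ) (x : ℝ) : ℝ := m + 2 * ∫ t in (0 : ℝ)..x, w t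

/-- The profile `1 / √W` belonging to the potential `W`. -/
def potentialProfile (m : ℝ) (w : ℝ → ℝ) (x : ℝ) : ℝ := 1 / √(potential m w x)

namespace IsForce

variable {k m ε : ℝ} {w : ℝ → ℝ}

theorem intervalIntegrable (h : IsForce k ε w) (a b : ℝ) : IntervalIntegrable w volume a b :=
  h.smooth.continuous.intervalIntegrable a b

theorem hasDerivAt_potential (h : IsForce k ε w) (x : ℝ) :
    HasDerivAt (potential m w) (2 * w x) x :=
  ((intervalIntegral.integral_hasDerivAt_right (h.intervalIntegrable 0 x)
    (h.smooth.continuous.stronglyMeasurableAtFilter _ _)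
    h.smooth.continuous.continuousAt).const_mul 2).const_add m

theorem potential_sub (h : IsForce k ε w) (x y : ℝ) :
    potential m w y - potential m w x = 2 * ∫ t in x..y, w t := by
  rw [potential, potential, ← intervalIntegral.integral_add_adjacent_intervals
    (h.intervalIntegrable 0 x) (h.intervalIntegrable x y)]
  ring

theorem contDiff_potential (h : IsForce k ε w) : ContDiff ℝ ∞ (potential m w) := by
  rw [contDiff_infty_iff_deriv]
  refine ⟨fun x => (h.hasDerivAt_potential x).differentiableAt, ?_⟩
  rw [show deriv (potential m w) = fun x => 2 * w x from
    funext fun x => (h.hasDerivAt_potential x).deriv]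
  exact contDiff_const.mul h.smooth

theorem potential_neg (h : IsForce k ε w) (x : ℝ) : potential m w (-x) = potential m w x := by
  have := intervalIntegral.integral_comp_neg (a := 0) (b := x) w
  simp only [h.odd, neg_zero, intervalIntegral.integral_neg] at this
  rw [potential, potential, intervalIntegral.integral_symm, ← this]
  simp

theorem potential_periodic (h : IsForce k ε w) : Function.Periodic (potential m w) 2 := fun x => by
  have h1 := h.potential_sub (m := m) x (x + 2)
  rw [h.periodic.intervalIntegral_add_eq x (-1)] at h1
  have h2 := h.potential_sub (m := m) (-1) (-1 + 2)
  rw [← h2] at h1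
  have h3 := h.potential_neg (m := m) 1
  norm_num at h1
  linarith

theorem apply_zero (h : IsForce k ε w) : w 0 = 0 := by
  have := h.odd 0
  simp at this
  linarith

theorem apply_one (h : IsForce k ε w) : w 1 = 0 := by
  have h1 := h.odd 1
  have h2 := h.periodic (-1)
  norm_num at h2
  linarith

theorem nonneg (h : IsForce k ε w) {x : ℝ} (hx : x ∈ Icc (0 : ℝ) 1) : 0 ≤ w x := by
  rcases eq_or_lt_of_le hx.1 with h0 | h0
  · rw [← h0, h.apply_zero]
  rcases eq_or_lt_of_le hx.2 with h1 | h1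
  · rw [h1, h.apply_one]
  · exact (h.pos x ⟨h0, h1⟩).le

/-- The equilibria are the integers. -/
theorem exists_int_of_eq_zero (h : IsForce k ε w) {x : ℝ} (hx : w x = 0) : ∃ n : ℤ, x = n := by
  obtain ⟨y, hy, n, hn⟩ := exists_mem_Icc_of_two_periodic x
  have hy0 : w y = 0 := by
    rcases hn with rfl | rfl
    · rwa [h.periodic.int_mul n] at hx
    · rw [h.periodic.int_mul n, h.odd] at hx
      linarith
  have : y = 0 ∨ y = 1 := by
    by_contra! hc
    exact (h.pos y ⟨lt_of_le_of_ne hy.1 hc.1.symm, lt_of_le_of_ne hy.2 hc.2⟩).ne' hy0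
  rcases this with rfl | rfl <;> rcases hn with rfl | rfl
  · exact ⟨n * 2, by push_cast; ring⟩
  · exact ⟨n * 2, by push_cast; ring⟩
  · exact ⟨1 + n * 2, by push_cast; ring⟩
  · exact ⟨-1 + n * 2, by push_cast; ring⟩

/-- A property of the values of the potential need only be checked on `[0, 1]`. -/
theorem forall_potential (h : IsForce k ε w) {P : ℝ → Prop}
    (hP : ∀ x ∈ Icc (0 : ℝ) 1, P (potential m w x)) (x : ℝ) : P (potential m w x) := by
  obtain ⟨y, hy, n, rfl | rfl⟩ := exists_mem_Icc_of_two_periodic x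
  · rw [h.potential_periodic.int_mul n]
    exact hP y hy
  · rw [h.potential_periodic.int_mul n, h.potential_neg]
    exact hP y hy

theorem le_potential (h : IsForce k ε w) (x : ℝ) : m ≤ potential m w x := by
  refine h.forall_potential (P := fun y => m ≤ y) (fun x hx => ?_) x
  have : 0 ≤ ∫ t in (0 : ℝ)..x, w t :=
    intervalIntegral.integral_nonneg hx.1 fun t ht => h.nonneg ⟨ht.1, ht.2.trans hx.2⟩
  rw [potential]
  linarith

theorem potential_strictMonoOn (h : IsForce k ε w) : StrictMonoOn (potential m w) (Icc 0 1) := by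
  refine strictMonoOn_of_deriv_pos (convex_Icc 0 1) h.contDiff_potential.continuous.continuousOn
    fun x hx => ?_
  rw [interior_Icc] at hx
  rw [(h.hasDerivAt_potential x).deriv]
  linarith [h.pos x hx]

theorem potential_eq (h : IsForce k ε w) {x : ℝ} (hx : x ∈ Icc (-1 + ε) (1 - ε)) :
    potential m w x = k * x ^ 2 + m := by
  have h0 : (0 : ℝ) ∈ Icc (-1 + ε) (1 - ε) := ⟨by linarith [hx.1, hx.2], by linarith [hx.1, hx.2]⟩
  rw [potential, intervalIntegral.integral_congr (g := fun t => k * t)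
    fun t ht => h.eq_linear t (uIcc_subset_Icc h0 hx ht), intervalIntegral.integral_const_mul,
    integral_id]
  ring

theorem potential_le (h : IsForce k ε w) {x : ℝ} (hx : x ∈ Icc (-1 : ℝ) 1) :
    potential m w x ≤ k * x ^ 2 + m := by
  wlog h0 : 0 ≤ x generalizing x
  · have := this (x := -x) ⟨by linarith [hx.2], by linarith [hx.1]⟩ (by linarith)
    rwa [h.potential_neg, neg_sq] at this
  have : ∫ t in (0 : ℝ)..x, w t ≤ ∫ t in (0 : ℝ)..x, k * t :=
    intervalIntegral.integral_mono_on h0 (h.intervalIntegrable _ _)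
      (Continuous.intervalIntegrable (by fun_prop) _ _)
      fun t ht => h.le_linear t ⟨ht.1, ht.2.trans hx.2⟩
  rw [intervalIntegral.integral_const_mul, integral_id] at this
  rw [potential]
  linarith

theorem le_potential_of_mem (h : IsForce k ε w) (hk : 0 < k) (hε : 0 < ε) (hε1 : ε < 1) {x : ℝ}
    (hx : x ∈ Icc (-1 : ℝ) 1) : k * x ^ 2 + m - 2 * k * ε ≤ potential m w x := by
  wlog h0 : 0 ≤ x generalizing x
  · have := this (x := -x) ⟨by linarith [hx.2], by linarith [hx.1]⟩ (by linarith)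
    rwa [h.potential_neg, neg_sq] at this
  have hkε : 0 < k * ε := mul_pos hk hε
  rcases le_total x (1 - ε) with h1 | h1
  · rw [h.potential_eq ⟨by linarith, h1⟩]
    linarith
  · have h2 := h.potential_strictMonoOn (m := m).monotoneOn (a := 1 - ε) (b := x)
      ⟨by linarith, by linarith⟩ ⟨h0, hx.2⟩ h1
    rw [h.potential_eq ⟨by linarith, le_rfl⟩] at h2
    have h3 : k * x ^ 2 ≤ k * 1 := mul_le_mul_of_nonneg_left (by nlinarith [hx.2]) hk.le
    nlinarith [mul_pos hkε hε]

/-- The profile has slope less than one, so that it is the arc-length form of a graph. -/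
theorem sq_lt_potential_pow (h : IsForce k ε w) (hk : 0 < k) (hε : 0 < ε) (hε1 : ε < 1)
    (hm : √k + 2 * k * ε ≤ m) (x : ℝ) : w x ^ 2 < potential m w x ^ 3 := by
  have main : ∀ y ∈ Icc (0 : ℝ) 1, w y ^ 2 < potential m w y ^ 3 := fun y hy => by
    have h1 := h.le_linear y hy
    have h2 := h.nonneg hy
    have h3 := h.le_potential_of_mem (m := m) hk hε hε1 (x := y) ⟨by linarith [hy.1], hy.2⟩
    have hs : 0 < √k := sqrt_pos.2 hk
    have h4 : k * y ^ 2 + √k ≤ potential m w y := by linarith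
    have h5 : 0 ≤ k * y ^ 2 := by positivity
    calc w y ^ 2 ≤ (k * y) ^ 2 := by gcongr
      _ = (k * y ^ 2) * √k ^ 2 := by rw [sq_sqrt hk.le]; ring
      _ < (k * y ^ 2 + √k) ^ 3 := by
        have : 0 < √k ^ 3 := by positivity
        have : 0 ≤ (k * y ^ 2) ^ 3 := by positivity
        have : 0 ≤ (k * y ^ 2) ^ 2 * √k := by positivity
        have : 0 ≤ (k * y ^ 2) * √k ^ 2 := by positivity
        nlinarith
      _ ≤ potential m w y ^ 3 := by gcongr
  obtain ⟨y, hy, n, rfl | rfl⟩ := exists_mem_Icc_of_two_periodic x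
  · rw [h.potential_periodic.int_mul n, h.periodic.int_mul n]
    exact main y hy
  · rw [h.potential_periodic.int_mul n, h.periodic.int_mul n, h.potential_neg, h.odd, neg_sq]
    exact main y hy

theorem isProfile (h : IsForce k ε w) (hm : 0 < m) : IsProfile 1 (potentialProfile m w) where
  half_period_pos := one_pos
  smooth := by
    have hp : ∀ x, 0 < potential m w x := fun x => hm.trans_le (h.le_potential x)
    exact contDiff_const.div (h.contDiff_potential.sqrt fun x => (hp x).ne')
      fun x => (sqrt_pos.2 (hp x)).ne'
  pos x := one_div_pos.2 (sqrt_pos.2 (hm.trans_le (h.le_potential x)))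
  even x := by rw [potentialProfile, h.potential_neg, potentialProfile]
  periodic x := by
    rw [mul_one, potentialProfile, h.potential_periodic, potentialProfile]
  strictMonoOn x hx y hy hxy := by
    have hp := hm.trans_le (h.le_potential (m := m) y)
    have := h.potential_strictMonoOn (m := m) (a := -y) (b := -x) ⟨by linarith [hy.2],
      by linarith [hy.1]⟩ ⟨by linarith [hx.2], by linarith [hx.1]⟩ (by linarith)
    rw [h.potential_neg, h.potential_neg] at this
    exact one_div_lt_one_div_of_lt (sqrt_pos.2 hp) (sqrt_lt_sqrt hp.le this)

theorem hasDerivAt_potentialProfile (h : IsForce k ε w) (hm : 0 < m) (x : ℝ) :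
    HasDerivAt (potentialProfile m w) (-w x / (√(potential m w x)) ^ 3) x := by
  have hp := hm.trans_le (h.le_potential (m := m) x)
  have hs := sqrt_pos.2 hp
  have := ((h.hasDerivAt_potential x).sqrt hp.ne').inv hs.ne'
  refine (this.congr_deriv ?_).congr_of_eventuallyEq (.of_forall fun y => one_div _)
  field_simp

theorem deriv_potentialProfile_sq_lt (h : IsForce k ε w) (hk : 0 < k) (hε : 0 < ε) (hε1 : ε < 1)
    (hm : √k + 2 * k * ε ≤ m) (x : ℝ) : deriv (potentialProfile m w) x ^ 2 < 1 := by
  have hm0 : 0 < m := lt_of_lt_of_le (by positivity) hm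
  have hp := hm0.trans_le (h.le_potential (m := m) x)
  rw [(h.hasDerivAt_potentialProfile hm0 x).deriv, div_pow, neg_sq, ← pow_mul,
    show 3 * 2 = 2 * 3 from rfl, pow_mul, sq_sqrt hp.le, div_lt_one (by positivity)]
  exact h.sq_lt_potential_pow hk hε hε1 hm x

theorem abs_potentialProfile_sub_le (h : IsForce k ε w) (hk : 0 < k) (hm : 0 < m) (hε : 0 < ε)
    (hε1 : ε < 1) {x : ℝ} (hx : x ∈ Icc (-1 : ℝ) 1) :
    |1 / √(k * x ^ 2 + m) - potentialProfile m w x| ≤ 2 * k * ε / (m * √m) := by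
  have h1 := h.le_potential_of_mem (m := m) hk hε hε1 hx
  have h2 := h.potential_le (m := m) hx
  have h3 := h.le_potential (m := m) x
  rw [potentialProfile]
  set a := √(k * x ^ 2 + m)
  set b := √(potential m w x)
  have hb : √m ≤ b := sqrt_le_sqrt h3
  have hab : b ≤ a := sqrt_le_sqrt h2
  have hs : 0 < √m := sqrt_pos.2 hm
  have hb0 : 0 < b := hs.trans_le hb
  have ha0 : 0 < a := hb0.trans_le hab
  have ea : a ^ 2 = k * x ^ 2 + m := sq_sqrt (by linarith)
  have eb : b ^ 2 = potential m w x := sq_sqrt (by linarith)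
  have em : √m ^ 2 = m := sq_sqrt hm.le
  have e : 1 / a - 1 / b = -((a - b) / (a * b)) := by field_simp; ring
  rw [e, abs_neg, abs_of_nonneg (by have := sub_nonneg.2 hab; positivity), div_le_div_iff₀
    (by positivity) (by positivity)]
  have hd : (a - b) * √m ≤ 2 * k * ε := by nlinarith
  have hmab : m ≤ a * b := by nlinarith
  calc (a - b) * (m * √m) = (a - b) * √m * m := by ring
    _ ≤ 2 * k * ε * (a * b) := by gcongr

end IsForce

/-! ### Recovering the graph from its arc-length form -/

theorem hasDerivAt_arcLength {f : ℝ → ℝ} (hf : ContDiff ℝ ∞ f) (x : ℝ) :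
    HasDerivAt (arcLength f) (√(1 + deriv f x ^ 2)) x := by
  have hc : Continuous fun t => √(1 + deriv f t ^ 2) := by
    have := hf.continuous_deriv (by simp)
    fun_prop
  exact intervalIntegral.integral_hasDerivAt_right (hc.intervalIntegrable _ _)
    (hc.stronglyMeasurableAtFilter _ _) hc.continuousAt

theorem arcLength_injective {f : ℝ → ℝ} (hf : ContDiff ℝ ∞ f) :
    Function.Injective (arcLength f) := by
  refine (strictMono_of_deriv_pos fun x => ?_).injective
  rw [(hasDerivAt_arcLength hf x).deriv]
  positivity

/-- A profile `F` with `|F'| < 1` is the arc-length form of a profile `f`: the abscissa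
`φ(X) = ∫₀ˣ √(1 - F'²)` is invertible and `f = F ∘ φ⁻¹`. -/
theorem exists_profile_of_arcLength {F : ℝ → ℝ} (hF : IsProfile 1 F)
    (hF' : ∀ x, deriv F x ^ 2 < 1) :
    ∃ (A : ℝ) (f : ℝ → ℝ), IsProfile A f ∧ arcLength f A = 1 ∧
      (∀ x, F (arcLength f x) = f x) ∧
      ∀ (x : ℝ) (n : ℤ), arcLength f x = n →
        (x : AddCircle (2 * A)) = (A : ℝ) ∨ (x : AddCircle (2 * A)) = (0 : ℝ) := by
  have hdF : ContDiff ℝ ∞ (deriv F) := hF.smooth.iterate_deriv 1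
  set ρ : ℝ → ℝ := fun x => √(1 - deriv F x ^ 2) with hρ
  have hpos : ∀ x, 0 < 1 - deriv F x ^ 2 := fun x => sub_pos.2 (hF' x)
  have ρpos : ∀ x, 0 < ρ x := fun x => sqrt_pos.2 (hpos x)
  have ρsm : ContDiff ℝ ∞ ρ :=
    (contDiff_const.sub (hdF.pow 2)).sqrt fun x => (hpos x).ne'
  have ρc := ρsm.continuous
  have ρi : ∀ a b, IntervalIntegrable ρ volume a b := fun a b => ρc.intervalIntegrable a b
  have dneg : ∀ x, deriv F (-x) = -deriv F x := fun x => by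
    have h1 : (fun y => F (-y)) = F := funext hF.even
    have h2 := deriv_comp_neg F x
    rw [h1] at h2
    linarith
  have dper : Function.Periodic (deriv F) 2 := fun x => by
    have h1 : (fun y => F (y + 2)) = F := funext fun y => by simpa using hF.periodic y
    rw [← deriv_comp_add_const F 2 x, h1]
  have ρneg : ∀ x, ρ (-x) = ρ x := fun x => by simp only [hρ, dneg, neg_sq]
  have ρper : Function.Periodic ρ 2 := fun x => by simp only [hρ, dper x]
  set φ : ℝ → ℝ := fun x => ∫ t in (0 : ℝ)..x, ρ t with hφ
  have φd : ∀ x, HasDerivAt φ (ρ x) x := fun x =>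
    intervalIntegral.integral_hasDerivAt_right (ρi 0 x) (ρc.stronglyMeasurableAtFilter _ _)
      ρc.continuousAt
  have φsm : ContDiff ℝ ∞ φ := by
    rw [contDiff_infty_iff_deriv]
    refine ⟨fun x => (φd x).differentiableAt, ?_⟩
    rwa [show deriv φ = ρ from funext fun x => (φd x).deriv]
  have φmono : StrictMono φ := strictMono_of_deriv_pos fun x => by rw [(φd x).deriv]; exact ρpos x
  have φ0 : φ 0 = 0 := by simp [hφ]
  have φneg : ∀ x, φ (-x) = -φ x := fun x => by
    have := intervalIntegral.integral_comp_neg (a := 0) (b := x) ρ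
    simp only [ρneg, neg_zero] at this
    simp only [hφ]
    rw [this, intervalIntegral.integral_symm]
  set A := φ 1 with hA
  have Apos : 0 < A := by
    rw [← φ0]
    exact φmono zero_lt_one
  have φadd : ∀ x, φ (x + 2) = φ x + 2 * A := fun x => by
    have e1 : ∫ t in x..(x + 2), ρ t = ∫ t in (-1 : ℝ)..(-1 + 2), ρ t :=
      ρper.intervalIntegral_add_eq x (-1)
    have e2 := intervalIntegral.integral_add_adjacent_intervals (ρi 0 x) (ρi x (x + 2))
    have e3 := intervalIntegral.integral_add_adjacent_intervals (ρi 0 (-1)) (ρi (-1) 1)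
    have e4 := φneg 1
    norm_num at e1
    simp only [hφ] at hA e4 ⊢
    rw [← e2, e1]
    linarith
  have φint : ∀ (x : ℝ) (n : ℤ), φ (x + n * 2) = φ x + n * (2 * A) := fun x n => by
    have hp : Function.Periodic (fun x => φ x - A * x) 2 := fun x => by
      simp only [φadd]; ring
    have := hp.int_mul n x
    linarith
  have φsurj : Function.Surjective φ := fun y => by
    obtain ⟨n, hn⟩ := exists_nat_gt (|y| / (2 * A))
    have hn' : |y| < n * (2 * A) := (div_lt_iff₀ (by positivity)).1 hn
    have e1 : φ (0 + (n : ℤ) * 2) = n * (2 * A) := by rw [φint, φ0]; simp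
    have e2 : φ (0 + (-n : ℤ) * 2) = -(n * (2 * A)) := by
      have := φint 0 (-n)
      push_cast at this ⊢
      rw [this, φ0]
      ring
    refine mem_range_of_exists_le_of_exists_ge φsm.continuous ⟨_, e2.trans_le ?_⟩ ⟨_, e1.ge.trans' ?_⟩
    · linarith [(abs_lt.1 hn').1]
    · linarith [(abs_lt.1 hn').2]
  -- the inverse `ψ` of `φ`
  set h : ℝ ≃ₜ ℝ := (φmono.orderIsoOfSurjective φ φsurj).toHomeomorph
  set ψ : ℝ → ℝ := fun x => h.symm x with hψ
  have φψ : ∀ x, φ (ψ x) = x := fun x => h.apply_symm_apply x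
  have ψφ : ∀ x, ψ (φ x) = x := fun x => h.symm_apply_apply x
  have ψsm : ContDiff ℝ ∞ ψ :=
    h.contDiff_symm_deriv (f' := ρ) (fun x => (ρpos x).ne') φd φsm
  have ψmono : StrictMono ψ := fun x y hxy => by
    rw [← φmono.lt_iff_lt, φψ, φψ]
    exact hxy
  have ψd : ∀ x, HasDerivAt ψ (ρ (ψ x))⁻¹ x := fun x =>
    HasDerivAt.of_local_left_inverse ψsm.continuous.continuousAt (φd (ψ x)) (ρpos _).ne'
      (Eventually.of_forall φψ)
  have ψ0 : ψ 0 = 0 := by simpa only [φ0] using ψφ 0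
  have ψneg : ∀ x, ψ (-x) = -ψ x := fun x => φmono.injective (by rw [φψ, φneg, φψ])
  have fsm : ContDiff ℝ ∞ fun x => F (ψ x) := hF.smooth.comp ψsm
  have fd : ∀ x, deriv (fun x => F (ψ x)) x = deriv F (ψ x) * (ρ (ψ x))⁻¹ := fun x =>
    (((hF.smooth.differentiable (by simp)) (ψ x)).hasDerivAt.comp x (ψd x)).deriv
  have hsq : ∀ x, √(1 + deriv (fun x => F (ψ x)) x ^ 2) = (ρ (ψ x))⁻¹ := fun x => by
    rw [fd]
    have h1 := ρpos (ψ x)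
    have h2 : ρ (ψ x) ^ 2 = 1 - deriv F (ψ x) ^ 2 := sq_sqrt (hpos _).le
    rw [sqrt_eq_iff_mul_self_eq (by positivity) (by positivity)]
    field_simp
    linarith
  have harc : ∀ x, arcLength (fun x => F (ψ x)) x = ψ x := fun x => by
    rw [arcLength, intervalIntegral.integral_congr (g := fun t => (ρ (ψ t))⁻¹) fun t _ => hsq t,
      intervalIntegral.integral_eq_sub_of_hasDerivAt (fun t _ => ψd t), ψ0, sub_zero]
    exact ((ρc.comp ψsm.continuous).inv₀ fun t => (ρpos _).ne').intervalIntegrable _ _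
  refine ⟨A, fun x => F (ψ x), ⟨Apos, fsm, fun x => hF.pos _, fun x => ?_, fun x => ?_, ?_⟩,
    ?_, fun x => by rw [harc], fun x n hx => ?_⟩
  · rw [ψneg, hF.even]
  · have : ψ (x + 2 * A) = ψ x + 2 := φmono.injective (by rw [φψ, φadd, φψ])
    rw [this]
    simpa using hF.periodic (ψ x)
  · have hmA : ψ (-A) = -1 := by rw [ψneg, hA, ψφ]
    intro x hx y hy hxy
    refine hF.strictMonoOn ⟨?_, ?_⟩ ⟨?_, ?_⟩ (ψmono hxy)
    · rw [← hmA]; exact ψmono.monotone hx.1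
    · rw [← ψ0]; exact ψmono.monotone hx.2
    · rw [← hmA]; exact ψmono.monotone hy.1
    · rw [← ψ0]; exact ψmono.monotone hy.2
  · rw [harc, hA, ψφ]
  · rw [harc] at hx
    have hxφ : x = φ n := by rw [← hx, φψ]
    obtain ⟨j, hj⟩ := Int.even_or_odd' n
    rcases hj with rfl | rfl
    · right
      have : x = 0 + j * (2 * A) := by
        rw [hxφ, ← φ0, ← φint]
        push_cast
        ring_nf
      rw [this, AddCircle.coe_add, AddCircle.coe_zero, zero_add, ← zsmul_eq_mul,
        AddCircle.coe_zsmul, AddCircle.coe_period, smul_zero]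
    · left
      have : x = A + j * (2 * A) := by
        rw [hxφ, hA, ← φint]
        push_cast
        ring_nf
      rw [this, AddCircle.coe_add, ← zsmul_eq_mul,
        AddCircle.coe_zsmul, AddCircle.coe_period, smul_zero, add_zero]

/-! ### Closed geodesics in the class of the parallels -/

theorem IsSobolevPair.of_hasDerivAt {u v : ℝ → ℝ} (hu : ∀ t, HasDerivAt u (v t) t)
    (hv : Continuous v) : IsSobolevPair u v := by
  obtain ⟨C, hC⟩ := isCompact_Icc.exists_bound_of_continuousOn (s := Icc (0 : ℝ) 1)
    hv.continuousOn
  refine ⟨MemLp.of_bound hv.aestronglyMeasurable C ((ae_restrict_iff' measurableSet_Ioc).2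
    (Eventually.of_forall fun t ht => hC t (Ioc_subset_Icc_self ht))), fun t _ => ?_⟩
  rw [intervalIntegral.integral_eq_sub_of_hasDerivAt (fun t _ => hu t)
    (hv.intervalIntegrable _ _)]
  ring

/-- A 1-periodic solution of `Y'' = -κ² w(Y)` is constant if `w' ≤ k` and `κ² k < 4π²`: the
velocity `Z = Y'` has mean zero and `∫ Z'² = κ² ∫ w'(Y) Z² ≤ κ² k ∫ Z²`, which contradicts
Wirtinger's inequality unless `Z = 0`. -/
theorem velocity_eq_zero {k κ : ℝ} {w Y Z : ℝ → ℝ} (hw : ContDiff ℝ ∞ w)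
    (hwk : ∀ x, deriv w x ≤ k) (hY : ∀ t, HasDerivAt Y (Z t) t)
    (hZ : ∀ t, HasDerivAt Z (-κ ^ 2 * w (Y t)) t) (hper : Function.Periodic Y 1)
    (hκ : κ ^ 2 * k < (2 * π) ^ 2) (t : ℝ) : Z t = 0 := by
  have Yc : Continuous Y := continuous_iff_continuousAt.2 fun t => (hY t).continuousAt
  have Zc : Continuous Z := continuous_iff_continuousAt.2 fun t => (hZ t).continuousAt
  have wc := hw.continuous
  have wdc : Continuous (deriv w) := hw.continuous_deriv (by simp)
  have Zper : Function.Periodic Z 1 := fun t => by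
    have h1 : HasDerivAt (fun s => Y (s + 1)) (Z (t + 1)) t :=
      (hY (t + 1)).comp_add_const t 1
    rw [show (fun s => Y (s + 1)) = Y from funext hper] at h1
    exact h1.unique (hY t)
  have hpair : IsSobolevPair Z fun t => -κ ^ 2 * w (Y t) := .of_hasDerivAt hZ (by fun_prop)
  have Z10 : Z 1 = Z 0 := by simpa using Zper 0
  have Y10 : Y 1 = Y 0 := by simpa using hper 0
  have hmean : ∫ t in (0 : ℝ)..1, Z t = 0 := by
    rw [intervalIntegral.integral_eq_sub_of_hasDerivAt (fun t _ => hY t)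
      (Zc.intervalIntegrable _ _), Y10, sub_self]
  have hwirt := wirtinger_inequality hpair Z10 hmean
  have hd : ∀ t, HasDerivAt (fun t => -κ ^ 2 * w (Y t)) (-κ ^ 2 * (deriv w (Y t) * Z t)) t :=
    fun t => (((hw.differentiable (by simp)) (Y t)).hasDerivAt.comp t (hY t)).const_mul _
  have hparts := hpair.integral_mul_deriv hd (by fun_prop)
  rw [Z10, Y10, sub_self, zero_sub, ← intervalIntegral.integral_neg] at hparts
  have hle : ∫ t in (0 : ℝ)..1, (-κ ^ 2 * w (Y t)) ^ 2 ≤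
      ∫ t in (0 : ℝ)..1, κ ^ 2 * k * Z t ^ 2 := by
    simp only [pow_two] at hparts ⊢
    rw [hparts]
    refine intervalIntegral.integral_mono_on zero_le_one
      (Continuous.intervalIntegrable (by fun_prop) _ _)
      (Continuous.intervalIntegrable (by fun_prop) _ _) fun t _ => ?_
    have : κ ^ 2 * Z t ^ 2 * deriv w (Y t) ≤ κ ^ 2 * Z t ^ 2 * k :=
      mul_le_mul_of_nonneg_left (hwk _) (by positivity)
    nlinarith
  rw [intervalIntegral.integral_const_mul] at hle
  have hzero : ∫ t in (0 : ℝ)..1, Z t ^ 2 ≤ 0 := by nlinarith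
  have hfr : Z t = Z (Int.fract t) := by
    have := Zper.sub_int_mul_eq ⌊t⌋ (x := t)
    rw [mul_one] at this
    exact this.symm
  rw [hfr]
  exact eq_zero_of_integral_sq_eq_zero Zc.continuousOn hzero
    ⟨Int.fract_nonneg t, (Int.fract_lt_one t).le⟩

/-- `f` is a profile of half-period `A` with `1 / f² = W ∘ arcLength f` for `W = potential m w`. The
last field says that the points at integral arc length are congruent to `0` or `A`; these are the
equilibria of the force. -/
structure IsGraphOfPotential (m A : ℝ) (w f : ℝ → ℝ) : Prop where
  isProfile : IsProfile A f
  sq_eq : ∀ x, f x ^ 2 = (potential m w (arcLength f x))⁻¹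
  coe_eq : ∀ (x : ℝ) (n : ℤ), arcLength f x = n →
    (x : AddCircle (2 * A)) = (A : ℝ) ∨ (x : AddCircle (2 * A)) = (0 : ℝ)

namespace IsGraphOfPotential

variable {k m ε A : ℝ} {w f : ℝ → ℝ}

theorem contDiff_fst (h : IsGraphOfPotential m A w f) :
    ContDiff ℝ ∞ fun x => 1 + deriv f x ^ 2 :=
  contDiff_const.add ((h.isProfile.smooth.iterate_deriv 1).pow 2)

theorem contDiff_snd (h : IsGraphOfPotential m A w f) : ContDiff ℝ ∞ fun x => f x ^ 2 :=
  h.isProfile.smooth.pow 2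

theorem hasDerivAt_sq (h : IsGraphOfPotential m A w f) (hw : IsForce k ε w) (hm : 0 < m) (x : ℝ) :
    HasDerivAt (fun x => f x ^ 2) (-2 * w (arcLength f x) * (f x ^ 2) ^ 2 *
      √(1 + deriv f x ^ 2)) x := by
  have hp := hm.trans_le (hw.le_potential (m := m) (arcLength f x))
  have := (((hw.hasDerivAt_potential (m := m) (arcLength f x)).comp x
    (hasDerivAt_arcLength h.isProfile.smooth x)).inv hp.ne')
  refine (this.congr_deriv ?_).congr_of_eventuallyEq (.of_forall h.sq_eq)
  rw [h.sq_eq]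
  simp only [Function.comp_apply]
  field_simp

theorem deriv_sq (h : IsGraphOfPotential m A w f) (hw : IsForce k ε w) (hm : 0 < m) :
    deriv (fun x => f x ^ 2) = fun x => -2 * w (arcLength f x) * (f x ^ 2) ^ 2 *
      √(1 + deriv f x ^ 2) :=
  funext fun x => (h.hasDerivAt_sq hw hm x).deriv

/-- In terms of the arc length `Y` along a geodesic `(x, θ)`, Clairaut's integral `κ = f² θ'` turns
the geodesic equations into `θ' = κ W(Y)` and `Y'' = -κ² w(Y)`. -/
theorem geodesic_equations (h : IsGraphOfPotential m A w f) (hw : IsForce k ε w) (hm : 0 < m)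
    {c : ℝ → Plane} (hc : ContDiff ℝ ∞ c)
    (hgeo : ∀ t, covDerivAlong (revolutionMetric f) c (deriv c) t = 0) :
    ∃ κ : ℝ, (∀ t, HasDerivAt (fun t => c t 1) (κ * potential m w (arcLength f (c t 0))) t) ∧
      ∃ Z : ℝ → ℝ, (∀ t, HasDerivAt (fun t => arcLength f (c t 0)) (Z t) t) ∧
        ∀ t, HasDerivAt Z (-κ ^ 2 * w (arcLength f (c t 0))) t := by
  have hfs := h.isProfile.smooth
  have hf0 : ∀ x, f x ^ 2 ≠ 0 := fun x => pow_ne_zero 2 (h.isProfile.pos x).ne'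
  have hE0 : ∀ x, 0 < 1 + deriv f x ^ 2 := fun x => by positivity
  have hEd : Differentiable ℝ fun x => 1 + deriv f x ^ 2 :=
    h.contDiff_fst.differentiable (by simp)
  have hGd : Differentiable ℝ fun x => f x ^ 2 := h.contDiff_snd.differentiable (by simp)
  rw [revolutionMetric_eq_diagMetric hfs] at hgeo
  have key := fun t => covDerivAlong_diagMetric hEd hGd (fun x => (hE0 x).ne') hf0 c (deriv c) t
  simp only [hgeo, Pi.zero_apply] at key
  have hc1 : ∀ t i, HasDerivAt (fun t => c t i) (deriv c t i) t := fun t i =>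
    hasDerivAt_pi.1 (hc.differentiable (by simp) t).hasDerivAt i
  have hc2 : ∀ t i, HasDerivAt (fun t => deriv c t i) (deriv (deriv c) t i) t := fun t i =>
    hasDerivAt_pi.1 ((hc.iterate_deriv 1).differentiable (by simp) t).hasDerivAt i
  have hG : ∀ t, HasDerivAt (fun t => f (c t 0) ^ 2)
      (deriv (fun x => f x ^ 2) (c t 0) * deriv c t 0) t := fun t =>
    HasDerivAt.comp (h₂ := fun x => f x ^ 2) t (hGd (c t 0)).hasDerivAt (hc1 t 0)
  have hE : ∀ t, HasDerivAt (fun t => 1 + deriv f (c t 0) ^ 2)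
      (deriv (fun x => 1 + deriv f x ^ 2) (c t 0) * deriv c t 0) t := fun t =>
    HasDerivAt.comp (h₂ := fun x => 1 + deriv f x ^ 2) t (hEd (c t 0)).hasDerivAt (hc1 t 0)
  have hclairaut : ∀ t, HasDerivAt (fun t => f (c t 0) ^ 2 * deriv c t 1) 0 t := fun t => by
    refine ((hG t).mul (hc2 t 1)).congr_deriv ?_
    have h2 := (key t).2
    have h3 : deriv (deriv c) t 1 = -(deriv (fun x => f x ^ 2) (c t 0) *
      (deriv c t 0 * deriv c t 1 + deriv c t 1 * deriv c t 0) / (2 * f (c t 0) ^ 2)) := by linarith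
    have hne := (h.isProfile.pos (c t 0)).ne'
    rw [h3]
    field_simp
    ring
  have hconst : ∀ t, f (c t 0) ^ 2 * deriv c t 1 = f (c 0 0) ^ 2 * deriv c 0 1 := fun t =>
    is_const_of_deriv_eq_zero (fun t => (hclairaut t).differentiableAt)
      (fun t => (hclairaut t).deriv) t 0
  set κ := f (c 0 0) ^ 2 * deriv c 0 1
  have hθ : ∀ t, deriv c t 1 = κ * potential m w (arcLength f (c t 0)) := fun t => by
    have hp := hm.trans_le (hw.le_potential (m := m) (arcLength f (c t 0)))
    rw [← hconst t, h.sq_eq]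
    field_simp
  refine ⟨κ, fun t => (hc1 t 1).congr_deriv (hθ t),
    fun t => √(1 + deriv f (c t 0) ^ 2) * deriv c t 0,
    fun t => HasDerivAt.comp (h₂ := arcLength f) t (hasDerivAt_arcLength hfs (c t 0)) (hc1 t 0),
    fun t => ?_⟩
  refine (((hE t).sqrt (hE0 _).ne').mul (hc2 t 0)).congr_deriv ?_
  have h1 := (key t).1
  rw [h.deriv_sq hw hm] at h1
  simp only at h1
  rw [← hconst t]
  have hs : √(1 + deriv f (c t 0) ^ 2) ^ 2 = 1 + deriv f (c t 0) ^ 2 := sq_sqrt (hE0 _).le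
  have hs0 : 0 < √(1 + deriv f (c t 0) ^ 2) := sqrt_pos.2 (hE0 _)
  set σ := √(1 + deriv f (c t 0) ^ 2)
  rw [← hs] at h1
  have h1' : deriv (deriv c) t 0 = -((deriv (fun x => 1 + deriv f x ^ 2) (c t 0) *
    (deriv c t 0 * deriv c t 0) - -2 * w (arcLength f (c t 0)) * (f (c t 0) ^ 2) ^ 2 * σ *
      (deriv c t 1 * deriv c t 1)) / (2 * σ ^ 2)) := by linarith
  rw [h1']
  field_simp
  ring

/-- The parallels at the critical points are the only closed geodesics in their class. -/
theorem eq_rotate_of_isClosedGeodesic (h : IsGraphOfPotential m A w f) (hw : IsForce k ε w)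
    (hm : 0 < m) (hkm : k < m ^ 2) {γ : C(LoopCircle, Torus A)}
    (hγ : IsClosedGeodesic (revolutionMetric f) γ) (hα : InClassAlpha γ) :
    ∃ s : LoopCircle, γ = rotate s (parallel A A) ∨ γ = rotate s (parallel A 0) := by
  obtain ⟨c, hlift, hc, hgeo⟩ := hγ
  have hper := hlift.add_one hα
  obtain ⟨κ, hθ, Z, hY, hZ⟩ := h.geodesic_equations hw hm hc hgeo
  have hYper : Function.Periodic (fun t => arcLength f (c t 0)) 1 := fun t => by
    simp only [(hper t).1]
  have hYc : Continuous fun t => arcLength f (c t 0) :=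
    continuous_iff_continuousAt.2 fun t => (hY t).continuousAt
  have hWc : Continuous fun t => potential m w (arcLength f (c t 0)) :=
    hw.contDiff_potential.continuous.comp hYc
  -- the total increment of `θ` is `2π` and `W ≥ m`, so `0 < κ m ≤ 2π`
  have hint : κ * ∫ t in (0 : ℝ)..1, potential m w (arcLength f (c t 0)) = 2 * π := by
    rw [← intervalIntegral.integral_const_mul, intervalIntegral.integral_eq_sub_of_hasDerivAt
      (fun t _ => hθ t) ((continuous_const.mul hWc).intervalIntegrable _ _)]
    have := (hper 0).2
    rw [zero_add] at this
    linarith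
  have hmW : m ≤ ∫ t in (0 : ℝ)..1, potential m w (arcLength f (c t 0)) := by
    have := intervalIntegral.integral_mono_on (μ := volume) (f := fun _ => m) zero_le_one (by simp)
      (hWc.intervalIntegrable 0 1) fun t _ => hw.le_potential _
    simpa using this
  have hκ0 : 0 < κ := by
    by_contra! hneg
    nlinarith [pi_pos]
  have hκm : κ * m ≤ 2 * π := by nlinarith
  have hκ : κ ^ 2 * k < (2 * π) ^ 2 :=
    calc κ ^ 2 * k < κ ^ 2 * m ^ 2 := by gcongr
      _ = (κ * m) ^ 2 := by ring
      _ ≤ (2 * π) ^ 2 := by gcongr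
  have hZ0 := velocity_eq_zero hw.smooth hw.deriv_le hY hZ hYper hκ
  have hYconst : ∀ t, arcLength f (c t 0) = arcLength f (c 0 0) := fun t =>
    is_const_of_deriv_eq_zero (fun t => (hY t).differentiableAt)
      (fun t => (hY t).deriv.trans (hZ0 t)) t 0
  have hw0 : w (arcLength f (c 0 0)) = 0 := by
    have h1 := hZ 0
    rw [show Z = fun _ => 0 from funext hZ0] at h1
    have h2 := h1.unique (hasDerivAt_const 0 0)
    rcases mul_eq_zero.1 h2 with h3 | h3
    · exact absurd h3 (neg_ne_zero.2 (pow_ne_zero 2 hκ0.ne'))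
    · exact h3
  obtain ⟨n, hn⟩ := hw.exists_int_of_eq_zero hw0
  have hx : ∀ t, c t 0 = c 0 0 := fun t => arcLength_injective h.isProfile.smooth (hYconst t)
  have hslope : κ * potential m w (arcLength f (c 0 0)) = 2 * π := by
    simpa [hYconst] using hint
  have hθlin : ∀ t, c t 1 = 2 * π * t + c 0 1 := fun t => by
    have hd : ∀ t, HasDerivAt (fun t => c t 1 - 2 * π * t) 0 t := fun t => by
      refine ((hθ t).sub ((hasDerivAt_id t).const_mul (2 * π))).congr_deriv ?_
      rw [hYconst, hslope]
      ring
    have := is_const_of_deriv_eq_zero (fun t => (hd t).differentiableAt)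
      (fun t => (hd t).deriv) t 0
    simp only [mul_zero, sub_zero] at this
    linarith
  refine ⟨((c 0 1 / (2 * π) : ℝ) : LoopCircle), ?_⟩
  rcases h.coe_eq _ n hn with h1 | h1
  · exact Or.inl (eq_rotate_parallel hlift hx hθlin h1)
  · exact Or.inr (eq_rotate_parallel hlift hx hθlin h1)

end IsGraphOfPotential

/-! ### The two parallels -/

namespace IsForce

variable {k m ε : ℝ} {w : ℝ → ℝ}

theorem deriv_zero (h : IsForce k ε w) (hε1 : ε < 1) : deriv w 0 = k := by
  have he : w =ᶠ[𝓝 0] fun x => k * x := by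
    filter_upwards [Icc_mem_nhds (by linarith : -1 + ε < 0) (by linarith : 0 < 1 - ε)] with x hx
    exact h.eq_linear x hx
  rw [he.deriv_eq]
  simp

end IsForce

namespace IsGraphOfPotential

variable {k m ε A : ℝ} {w f : ℝ → ℝ} {x₀ : ℝ}

theorem deriv_sq_eq_zero (h : IsGraphOfPotential m A w f) (hw : IsForce k ε w) (hm : 0 < m)
    (hx : w (arcLength f x₀) = 0) : deriv (fun x => f x ^ 2) x₀ = 0 := by
  simp [h.deriv_sq hw hm, hx]

/-- The sign of `(f²)''` at an equilibrium is opposite to that of `w'`. -/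
theorem deriv_deriv_sq (h : IsGraphOfPotential m A w f) (hw : IsForce k ε w) (hm : 0 < m)
    (hx : w (arcLength f x₀) = 0) : deriv (deriv fun x => f x ^ 2) x₀ =
      -2 * deriv w (arcLength f x₀) * (1 + deriv f x₀ ^ 2) * (f x₀ ^ 2) ^ 2 := by
  have hE0 : 0 < 1 + deriv f x₀ ^ 2 := by positivity
  have h1 : HasDerivAt (fun x => w (arcLength f x))
      (deriv w (arcLength f x₀) * √(1 + deriv f x₀ ^ 2)) x₀ :=
    HasDerivAt.comp x₀ ((hw.smooth.differentiable (by simp)) _).hasDerivAt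
      (hasDerivAt_arcLength h.isProfile.smooth x₀)
  have h2 : DifferentiableAt ℝ (fun x => (f x ^ 2) ^ 2) x₀ :=
    (h.contDiff_snd.differentiable (by simp) x₀).pow 2
  have h3 : DifferentiableAt ℝ (fun x => √(1 + deriv f x ^ 2)) x₀ :=
    (h.contDiff_fst.differentiable (by simp) x₀).sqrt hE0.ne'
  have h4 := (((h1.const_mul (-2)).mul h2.hasDerivAt).mul h3.hasDerivAt).deriv
  rw [h.deriv_sq hw hm]
  refine h4.trans ?_
  simp only [Pi.mul_apply, hx]
  have hs : √(1 + deriv f x₀ ^ 2) * √(1 + deriv f x₀ ^ 2) = 1 + deriv f x₀ ^ 2 :=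
    mul_self_sqrt hE0.le
  linear_combination (-2 * deriv w (arcLength f x₀) * (f x₀ ^ 2) ^ 2) * hs

theorem isClosedGeodesic_parallel (h : IsGraphOfPotential m A w f) (hw : IsForce k ε w)
    (hm : 0 < m) (hx : w (arcLength f x₀) = 0) :
    IsClosedGeodesic (revolutionMetric f) (parallel A x₀) := by
  refine ⟨_, isLift_parallel A x₀, ?_, fun t => ?_⟩
  · rw [contDiff_pi]
    intro i
    fin_cases i
    · exact contDiff_const
    · exact contDiff_const.mul contDiff_id
  · rw [revolutionMetric_eq_diagMetric h.isProfile.smooth]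
    have hd : deriv (fun t => (![x₀, 2 * π * t] : Plane)) = fun _ => ![0, 2 * π] :=
      funext fun t => deriv_parallel x₀ t
    obtain ⟨e0, e1⟩ := covDerivAlong_diagMetric (h.contDiff_fst.differentiable (by simp))
      (h.contDiff_snd.differentiable (by simp)) (fun x => by positivity)
      (fun x => pow_ne_zero 2 (h.isProfile.pos x).ne') (fun t => (![x₀, 2 * π * t] : Plane))
      (deriv fun t => (![x₀, 2 * π * t] : Plane)) t
    simp only [hd, Matrix.cons_val_zero, Matrix.cons_val_one,
      h.deriv_sq_eq_zero hw hm hx, deriv_const] at e0 e1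
    rw [hd]
    ext i
    fin_cases i
    · simpa using e0
    · simpa using e1

theorem isNondegenerate_and_hasIndex_zero (h : IsGraphOfPotential m A w f) (hw : IsForce k ε w)
    (hm : 0 < m) (hx : w (arcLength f x₀) = 0) (hmin : deriv w (arcLength f x₀) < 0) :
    IsNondegenerate (revolutionMetric f) (parallel A x₀) ∧
      HasIndex (revolutionMetric f) (parallel A x₀) 0 := by
  have hgeo := h.isClosedGeodesic_parallel hw hm hx
  rw [revolutionMetric_eq_diagMetric h.isProfile.smooth] at hgeo ⊢
  have hG := h.deriv_sq_eq_zero hw hm hx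
  have hE0 : 0 < 1 + deriv f x₀ ^ 2 := by positivity
  have hG0 : 0 < f x₀ ^ 2 := pow_pos (h.isProfile.pos x₀) 2
  have hpos : 0 < deriv (deriv fun x => f x ^ 2) x₀ := by
    rw [h.deriv_deriv_sq hw hm hx]
    exact mul_pos (mul_pos (by linarith) hE0) (by positivity)
  refine ⟨isNondegenerate_parallel h.contDiff_fst h.contDiff_snd hG hG0 ?_ hgeo,
    hasIndex_parallel_zero h.contDiff_fst h.contDiff_snd hG hE0 hG0 hpos⟩
  intro u v _ _ _ hq
  have h1 := mul_nonneg hE0.le (integral_sq_nonneg v)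
  have h2 : 0 < 2 * π ^ 2 * deriv (deriv fun x => f x ^ 2) x₀ := by positivity
  by_contra! hlt
  linarith [mul_pos h2 hlt]

theorem isNondegenerate_and_hasIndex_one (h : IsGraphOfPotential m A w f) (hw : IsForce k ε w)
    (hm : 0 < m) (hx : w (arcLength f x₀) = 0) (hmax : 0 < deriv w (arcLength f x₀))
    (hbound : deriv w (arcLength f x₀) * (f x₀ ^ 2) ^ 2 < 1) :
    IsNondegenerate (revolutionMetric f) (parallel A x₀) ∧
      HasIndex (revolutionMetric f) (parallel A x₀) 1 := by
  have hgeo := h.isClosedGeodesic_parallel hw hm hx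
  rw [revolutionMetric_eq_diagMetric h.isProfile.smooth] at hgeo ⊢
  have hG := h.deriv_sq_eq_zero hw hm hx
  have hE0 : 0 < 1 + deriv f x₀ ^ 2 := by positivity
  have hG0 : 0 < f x₀ ^ 2 := pow_pos (h.isProfile.pos x₀) 2
  have hneg : deriv (deriv fun x => f x ^ 2) x₀ < 0 := by
    rw [h.deriv_deriv_sq hw hm hx]
    exact mul_neg_of_neg_of_pos (mul_neg_of_neg_of_pos (by linarith) hE0) (by positivity)
  have hsum : 0 < 2 * (1 + deriv f x₀ ^ 2) + deriv (deriv fun x => f x ^ 2) x₀ := by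
    rw [h.deriv_deriv_sq hw hm hx]
    nlinarith [mul_pos hE0 (sub_pos.2 hbound)]
  refine ⟨isNondegenerate_parallel h.contDiff_fst h.contDiff_snd hG hG0 ?_ hgeo,
    hasIndex_parallel_one h.contDiff_fst h.contDiff_snd hG hE0 hG0 hneg hsum⟩
  intro u v huv hper hmean hq
  have hmean' : ∫ t in (0 : ℝ)..1, u t = 0 :=
    (mul_eq_zero.1 hmean).resolve_left (mul_neg_of_pos_of_neg (by positivity) hneg).ne
  have h1 := mul_le_mul_of_nonneg_left (wirtinger_inequality huv hper hmean') hE0.le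
  have h2 : 0 < 2 * π ^ 2 * (2 * (1 + deriv f x₀ ^ 2) + deriv (deriv fun x => f x ^ 2) x₀) := by
    positivity
  by_contra! hlt
  linarith [mul_pos h2 hlt]

end IsGraphOfPotential

theorem tendstoUniformlyOn_of_abs_sub_le {F : ℝ → ℝ → ℝ} {G : ℝ → ℝ} {s : Set ℝ} {C ε₀ : ℝ}
    (hε₀ : 0 < ε₀) (h : ∀ ε, 0 < ε → ε < ε₀ → ∀ x ∈ s, |G x - F ε x| ≤ C * ε) :
    TendstoUniformlyOn F G (𝓝[>] 0) s := by
  rw [Metric.tendstoUniformlyOn_iff]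
  intro δ hδ
  have hlim : Tendsto (fun ε : ℝ => C * ε) (𝓝[>] 0) (𝓝 0) := by
    have : Tendsto (fun ε : ℝ => C * ε) (𝓝 0) (𝓝 (C * 0)) :=
      (continuous_const.mul continuous_id).tendsto 0
    rw [mul_zero] at this
    exact this.mono_left nhdsWithin_le_nhds
  filter_upwards [hlim.eventually_lt_const hδ, Ioo_mem_nhdsGT hε₀] with ε h1 h2 x hx
  exact (h ε h2.1 h2.2 x hx).trans_lt h1

end TorusOfRevolution

end

open TorusOfRevolution in
theorem lemma1p6 (k m : ℝ) (hk : 0 < k) (hm : 0 < m) (hkm : √k < m) :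
    ∃ ε₀ : ℝ, 0 < ε₀ ∧ ∃ F : ℝ → ℝ → ℝ,
      (∀ ε : ℝ, 0 < ε → ε < ε₀ →
        TorusOfRevolution.IsProfile 1 (F ε) ∧
        (∀ X ∈ Set.Icc (-1 + ε) (1 - ε), F ε X = 1 / √(k * X ^ 2 + m)) ∧
        ∃ (A : ℝ) (f : ℝ → ℝ),
          TorusOfRevolution.IsProfile A f ∧
          TorusOfRevolution.IsArcLengthForm A f 1 (F ε) ∧
          -- the parallels at `X = ±1` and at `X = 0` are closed geodesics in class `α`
          (TorusOfRevolution.IsClosedGeodesic (TorusOfRevolution.revolutionMetric f)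
              (TorusOfRevolution.parallel A A) ∧
            TorusOfRevolution.InClassAlpha (TorusOfRevolution.parallel A A)) ∧
          (TorusOfRevolution.IsClosedGeodesic (TorusOfRevolution.revolutionMetric f)
              (TorusOfRevolution.parallel A 0) ∧
            TorusOfRevolution.InClassAlpha (TorusOfRevolution.parallel A 0)) ∧
          -- up to the choice of the initial point there are no others
          (∀ γ : C(TorusOfRevolution.LoopCircle, TorusOfRevolution.Torus A),
            TorusOfRevolution.IsClosedGeodesic (TorusOfRevolution.revolutionMetric f) γ →
            TorusOfRevolution.InClassAlpha γ →
              ∃ s : TorusOfRevolution.LoopCircle,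
                γ = TorusOfRevolution.rotate s (TorusOfRevolution.parallel A A) ∨
                γ = TorusOfRevolution.rotate s (TorusOfRevolution.parallel A 0)) ∧
          TorusOfRevolution.IsNondegenerate (TorusOfRevolution.revolutionMetric f)
            (TorusOfRevolution.parallel A A) ∧
          TorusOfRevolution.IsNondegenerate (TorusOfRevolution.revolutionMetric f)
            (TorusOfRevolution.parallel A 0) ∧
          TorusOfRevolution.HasIndex (TorusOfRevolution.revolutionMetric f)
            (TorusOfRevolution.parallel A A) 0 ∧
          TorusOfRevolution.HasIndex (TorusOfRevolution.revolutionMetric f)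
            (TorusOfRevolution.parallel A 0) 1) ∧
      TendstoUniformlyOn F (fun X => 1 / √(k * X ^ 2 + m)) (𝓝[>] 0) (Set.Icc (-1) 1) := by
  have hforce : ∀ ε : ℝ, 0 < ε → ε < 1 → ∃ w, IsForce k ε w := fun ε h0 h1 =>
    exists_isForce hk h0 h1
  choose! w hw using hforce
  have hk2 : 0 < 2 * k := by linarith
  have hkm2 : k < m ^ 2 := by
    rw [← sq_sqrt hk.le]
    gcongr
  -- the second bound makes the profile have slope less than one
  refine ⟨min 1 ((m - √k) / (2 * k)), lt_min one_pos (div_pos (sub_pos.2 hkm) hk2),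
    fun ε => potentialProfile m (w ε), fun ε h0 hε => ?_, ?_⟩
  · have h1 : ε < 1 := hε.trans_le (min_le_left _ _)
    have h2 : √k + 2 * k * ε ≤ m := by
      have := (lt_div_iff₀ hk2).1 (hε.trans_le (min_le_right _ _))
      linarith
    have hwε := hw ε h0 h1
    have hF := hwε.isProfile hm
    refine ⟨hF, fun X hX => by simp only [potentialProfile, hwε.potential_eq hX], ?_⟩
    obtain ⟨A, f, hf, hA, hFf, hcoe⟩ := exists_profile_of_arcLength hF
      (hwε.deriv_potentialProfile_sq_lt hk h0 h1 h2)
    have hgr : IsGraphOfPotential m A (w ε) f := ⟨hf, fun x => by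
      rw [← hFf x, potentialProfile, div_pow, sq_sqrt (hm.trans_le (hwε.le_potential _)).le,
        one_pow, one_div], hcoe⟩
    have hzero : arcLength f 0 = 0 := intervalIntegral.integral_same
    have wA : w ε (arcLength f A) = 0 := by rw [hA, hwε.apply_one]
    have w0 : w ε (arcLength f 0) = 0 := by rw [hzero, hwε.apply_zero]
    have nA := hgr.isNondegenerate_and_hasIndex_zero hwε hm wA (by rw [hA]; exact hwε.deriv_one)
    have hd0 : deriv (w ε) (arcLength f 0) = k := by rw [hzero, hwε.deriv_zero h1]
    have n0 := hgr.isNondegenerate_and_hasIndex_one hwε hm w0 (by rwa [hd0]) (by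
      rw [hd0, hgr.sq_eq, hzero, potential, intervalIntegral.integral_same, mul_zero, add_zero,
        inv_pow, ← div_eq_mul_inv, div_lt_one (by positivity)]
      exact hkm2)
    exact ⟨A, f, hf, ⟨hA, fun x _ => hFf x⟩,
      ⟨hgr.isClosedGeodesic_parallel hwε hm wA, inClassAlpha_parallel A A⟩,
      ⟨hgr.isClosedGeodesic_parallel hwε hm w0, inClassAlpha_parallel A 0⟩,
      fun γ hγ hα => hgr.eq_rotate_of_isClosedGeodesic hwε hm hkm2 hγ hα,
      nA.1, n0.1, nA.2, n0.2⟩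
  · refine tendstoUniformlyOn_of_abs_sub_le (C := 2 * k / (m * √m)) one_pos
      fun ε h0 h1 x hx => ?_
    have := (hw ε h0 h1).abs_potentialProfile_sub_le hk hm h0 h1 hx
    rwa [mul_div_right_comm] at this
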